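/- Let $P$ be a finite poset with a unique minimal element $\hat 0$ and a unique maximal element $\hat 1$, all of whose intervals are graded, with rank function $\rho$ (so $\rho(\hat 0)=0$), and let $n=\rho(\hat 1)\ge 3$ be its rank. For $x\le y$ call $[x,y]$ an $m$-interval if $\rho(y)-\rho(x)=m$. Assume the following. (a) $P$ is Eulerian: every interval $[x,y]$ with $x<y$ has as many elements of even rank as of odd rank. (b) $P$ is a Sheffer poset with Sheffer factorial function $D$ and binomial factorial function $B$: for each $m$, every $m$-interval $[\hat 0,y]$ has the same number $D(m)$ of maximal chains, and every $m$-interval $[x,y]$ with $x\neq\hat 0$ has the same number $B(m)$ of maximal chains. (c) $B(3)=D(3)=6$, that is, every $3$-interval of $P$ has exactly $6$ maximal chains. (If $n=3$, there is no $3$-interval $[x,y]$ with $x\ne\hat 0$, and the condition on $B(3)$ is empty.) Let $B_n$ denote the boolean lattice of all subsets of $\{1,\dots,n\}$ ordered by inclusion, and for an integer $k\ge1$ let $\boxplus^k(B_n)$, the $k$-summation of $B_n$, be the poset obtained from $k$ disjoint copies of $B_n$ by identifying all the minimal elements with one another and all the maximal elements with one another. Then: (i) if $n$ is odd, there is an integer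 $k\ge 1$ such that $P$ is isomorphic to $\boxplus^k(B_n)$; (ii) if $n$ is even, $P$ is isomorphic to $B_n$. -/

import Mathlib

namespace ShefferPoset

/-! Throughout, a finite poset with least element `⊥` and greatest element `⊤` all of whose intervals
are graded is encoded by `[PartialOrder P] [BoundedOrder P] [Finite P] [GradeMinOrder ℕ P]`. The rank
function is `grade ℕ : P → ℕ` (strictly monotone, increasing by exactly one along each covering
relation, and zero at `⊥`), and the rank of `P` is `grade ℕ (⊤ : P)`. -/

section Graded

variable (P : Type*) [PartialOrder P] [GradeMinOrder ℕ P]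

/-- Euler-Poincaré relation on every interval with more than one element: as many elements of even
rank as of odd rank. -/
def IsEulerian : Prop :=
  ∀ x y : P, x < y →
    {z : P | z ∈ Set.Icc x y ∧ Even (grade ℕ z)}.ncard =
      {z : P | z ∈ Set.Icc x y ∧ Odd (grade ℕ z)}.ncard

variable {P}

/-- `[x, y]` is an `n`-interval: `x ≤ y`, and the ranks of `x` and `y` differ by `n`. -/
def IsNInterval (n : ℕ) (x y : P) : Prop :=
  x ≤ y ∧ grade ℕ y = grade ℕ x + n

/-- The number of maximal chains of the interval `[x, y]`. -/
noncomputable def numMaxChains {P : Type*} [PartialOrder P] (x y : P) : ℕ :=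
  Nat.card (Flag (Set.Icc x y))

variable (P) [BoundedOrder P]

/-- Sheffer posets: for each `n`, any two `n`-intervals starting at the least element have the same
number of maximal chains, and so do any two `n`-intervals not starting at the least element. -/
structure IsSheffer : Prop where
  sheffer_intervals : ∀ (n : ℕ) (y v : P),
    IsNInterval n ⊥ y → IsNInterval n ⊥ v → numMaxChains ⊥ y = numMaxChains ⊥ v
  binomial_intervals : ∀ (n : ℕ) (x y u v : P), x ≠ ⊥ → u ≠ ⊥ →
    IsNInterval n x y → IsNInterval n u v → numMaxChains x y = numMaxChains u v

/-- `D` is the Sheffer factorial function of `P`: each `n`-interval `[⊥, y]` has `D n` maximal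
chains. -/
def IsShefferFactorial (D : ℕ → ℕ) : Prop :=
  ∀ (n : ℕ) (y : P), IsNInterval n ⊥ y → numMaxChains ⊥ y = D n

/-- `B` is the binomial factorial function of `P`: each `n`-interval `[x, y]` with `x ≠ ⊥` has `B n`
maximal chains. -/
def IsBinomialFactorial (B : ℕ → ℕ) : Prop :=
  ∀ (n : ℕ) (x y : P), x ≠ ⊥ → IsNInterval n x y → numMaxChains x y = B n

end Graded

/-- The boolean lattice of rank `n`: the subsets of an `n`-element set, ordered by inclusion. -/
abbrev BooleanLattice (n : ℕ) : Type := Finset (Fin n)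

/-- The disjoint union of `k` copies of `P`; `⟨i, x⟩` is the element `x` of the `i`-th copy. -/
structure Copies (k : ℕ) (P : Type*) where
  idx : Fin k
  val : P

/-- The preorder on `k` copies of `P` in which, besides the relations inside each copy, every copy of
`⊥` is below everything and every copy of `⊤` is above everything. -/
instance Copies.instPreorder (k : ℕ) (P : Type*) [PartialOrder P] [BoundedOrder P] :
    Preorder (Copies k P) where
  le a b := a.val = ⊥ ∨ b.val = ⊤ ∨ (a.idx = b.idx ∧ a.val ≤ b.val)
  le_refl a := Or.inr (Or.inr ⟨rfl, le_rfl⟩)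
  le_trans a b c hab hbc := by
    rcases hab with h | h | ⟨h1, h2⟩
    · exact Or.inl h
    · rcases hbc with h' | h' | ⟨_, h2'⟩
      · left
        have hbt : (⊥ : P) = ⊤ := h'.symm.trans h
        exact le_bot_iff.mp (hbt ▸ le_top)
      · exact Or.inr (Or.inl h')
      · exact Or.inr (Or.inl (top_le_iff.mp (h ▸ h2')))
    · rcases hbc with h' | h' | ⟨h1', h2'⟩
      · exact Or.inl (le_bot_iff.mp (h' ▸ h2))
      · exact Or.inr (Or.inl h')
      · exact Or.inr (Or.inr ⟨h1.trans h1', h2.trans h2'⟩)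

/-- The `k`-summation of `P`: `k` copies of `P` with all the least elements identified and all the
greatest elements identified. -/
abbrev KSummation (k : ℕ) (P : Type*) [PartialOrder P] [BoundedOrder P] : Type _ :=
  Antisymmetrization (Copies k P) (· ≤ ·)

end ShefferPoset

/-! Every interval of small rank is shown to be boolean, and the bound is raised two ranks at a
time. Rank 2 follows from the Euler relation, and rank 3 from having 6 maximal chains, hence 3
coatoms (`allBoolean_three`).

Suppose all intervals of rank at most `m` are boolean, with `m ≥ 3`, and let `[x, y]` have rank `m +
1`. Each lower cover of a coatom `c` lies below exactly one other coatom. Call two coatoms linked if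
some element other than `x` lies below both. This is an equivalence relation whose classes have `m +
1` coatoms, and an element strictly between `x` and `y` is determined by the coatoms above it, all
in one class. So each class carries one boolean lattice, the lattices meet only in `x` and `y`, and
`[x, y]` is a `k`-summation (`IsLocallyBoolean.exists_kSummation`).

Now let `m` be even and `[x, y]` have rank `m + 2`. By the Sheffer condition its lower intervals of
corank one share one multiplicity `k`, and its upper ones share one multiplicity `k'`. Double
counting makes the rank numbers from 2 to `m` a multiple `e` of the binomial coefficients, while
ranks 1 and `m + 1` are further divided by `k'` and `k`. The Euler relation then forces `k = k' = e
= 1` (`AllBoolean.ncard_of_even`). Every interval of rank `m + 1` sits inside one of rank `m + 2` as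
long as `m + 2 ≤ n`, so the induction proceeds (`AllBoolean.add_two`). For even `n` it reaches `P`
itself. For odd `n` it stops at rank `n - 1`, and `P` is a summation with a multiplicity left free.
-/

namespace ShefferPoset

open Set Order

/-! ### Counting maximal chains of intervals -/

section Chains

variable {P : Type*} [PartialOrder P]

/-- The maximal chains of `[x, y]`, as sets of elements of the ambient poset. -/
def maxChainsIn (x y : P) : Set (Set P) :=
  {s | Maximal (fun t : Set P => t ⊆ Icc x y ∧ IsChain (· ≤ ·) t) s}

/-- The elements of `[x, y]` covered by `y`. -/
def coatomsIn (x y : P) : Set P := {c | x ≤ c ∧ c ⋖ y}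

/-- The elements of `[x, y]` covering `x`. -/
def atomsIn (x y : P) : Set P := {a | x ⋖ a ∧ a ≤ y}

theorem mem_of_comparable {x y w : P} {s : Set P} (hs : s ∈ maxChainsIn x y)
    (hw : w ∈ Icc x y) (h : ∀ b ∈ s, b ≤ w ∨ w ≤ b) : w ∈ s := by
  have := hs.2 (y := insert w s) ⟨insert_subset hw hs.1.1, hs.1.2.insert fun b hb _ => (h b hb).symm⟩
    (subset_insert _ _)
  exact this (mem_insert _ _)

theorem mem_maxChainsIn_of_forall {x y : P} {s : Set P} (hs : s ⊆ Icc x y)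
    (hc : IsChain (· ≤ ·) s)
    (h : ∀ w ∈ Icc x y, (∀ b ∈ s, b ≤ w ∨ w ≤ b) → w ∈ s) : s ∈ maxChainsIn x y := by
  refine ⟨⟨hs, hc⟩, fun t ht hst w hw => h w (ht.1 hw) fun b hb => ht.2.total (hst hb) hw⟩

/-- Flags live in a type that depends on the endpoints; as sets in `P`, chains of different
intervals can be compared and extended. -/
theorem numMaxChains_eq_card (x y : P) : numMaxChains x y = Nat.card (maxChainsIn x y) := by
  refine Nat.card_eq_of_bijective
    (fun F : Flag (Icc x y) => (⟨Subtype.val '' (F : Set (Icc x y)), ?_⟩ : maxChainsIn x y)) ⟨?_, ?_⟩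
  · refine mem_maxChainsIn_of_forall (by rintro _ ⟨a, _, rfl⟩; exact a.2) ?_ ?_
    · rintro _ ⟨a, ha, rfl⟩ _ ⟨b, hb, rfl⟩ _
      exact F.le_or_le ha hb
    · intro w hw h
      refine ⟨⟨w, hw⟩, ?_, rfl⟩
      have := F.max_chain' (s := insert (⟨w, hw⟩ : Icc x y) (F : Set (Icc x y)))
        (F.chain_le.insert fun b hb _ => (h b ⟨b, hb, rfl⟩).symm) (subset_insert _ _)
      change _ ∈ F.carrier
      rw [this]; exact mem_insert _ _
  · intro F G h
    have := congrArg Subtype.val h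
    exact Flag.ext (Subtype.val_injective.image_injective this)
  · rintro ⟨s, hs⟩
    have him : Subtype.val '' (Subtype.val ⁻¹' s : Set (Icc x y)) = s := by
      rw [Subtype.image_preimage_coe, inter_eq_right]; exact hs.1.1
    refine ⟨⟨Subtype.val ⁻¹' s, ?_, ?_⟩, Subtype.ext him⟩
    · intro a ha b hb _
      exact hs.1.2.total ha hb
    · intro t ht hst
      refine Subset.antisymm hst fun w hw => ?_
      exact mem_of_comparable (w := w.1) hs w.2 fun b hb =>
        ht.total (hst (a := ⟨b, hs.1.1 hb⟩) hb) hw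

theorem insert_mem_maxChainsIn {x y z : P} (hz : z ∈ coatomsIn x y) {s : Set P}
    (hs : s ∈ maxChainsIn x z) : insert y s ∈ maxChainsIn x y := by
  have hzs : z ∈ s := mem_of_comparable hs ⟨hz.1, le_rfl⟩ fun b hb => Or.inl (hs.1.1 hb).2
  refine mem_maxChainsIn_of_forall ?_ ?_ ?_
  · exact insert_subset ⟨hz.1.trans hz.2.le, le_rfl⟩
      (hs.1.1.trans (Icc_subset_Icc_right hz.2.le))
  · exact hs.1.2.insert fun b hb _ => Or.inr ((hs.1.1 hb).2.trans hz.2.le)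
  · intro w hw h
    rcases h z (mem_insert_of_mem _ hzs) with h1 | h1
    · rcases hz.2.eq_or_eq h1 hw.2 with rfl | rfl
      · exact mem_insert_of_mem _ hzs
      · exact mem_insert _ _
    · exact mem_insert_of_mem _ (mem_of_comparable hs ⟨hw.1, h1⟩
        fun b hb => h b (mem_insert_of_mem _ hb))

theorem exists_insert_eq [Finite P] {x y : P} (hxy : x < y) {s : Set P}
    (hs : s ∈ maxChainsIn x y) :
    ∃ z ∈ coatomsIn x y, ∃ t ∈ maxChainsIn x z, insert y t = s := by
  have hys : y ∈ s := mem_of_comparable hs ⟨hxy.le, le_rfl⟩ fun b hb => Or.inl (hs.1.1 hb).2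
  have hxs : x ∈ s := mem_of_comparable hs ⟨le_rfl, hxy.le⟩ fun b hb => Or.inr (hs.1.1 hb).1
  obtain ⟨z, hz⟩ := (toFinite (s \ {y})).exists_maximal ⟨x, hxs, hxy.ne⟩
  have hmax : ∀ b ∈ s, b ≠ y → b ≤ z := fun b hb hby =>
    (hs.1.2.total hb hz.1.1).elim id fun h => hz.2 ⟨hb, hby⟩ h
  have hzy : z < y := lt_of_le_of_ne (hs.1.1 hz.1.1).2 hz.1.2
  have hcov : z ⋖ y := by
    refine ⟨hzy, fun w h1 h2 => ?_⟩
    have hw : w ∈ s := mem_of_comparable hs ⟨(hs.1.1 hz.1.1).1.trans h1.le, h2.le⟩ fun b hb => by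
      by_cases hby : b = y
      · exact Or.inr (hby ▸ h2.le)
      · exact Or.inl ((hmax b hb hby).trans h1.le)
    exact (hmax w hw h2.ne).not_gt h1
  refine ⟨z, ⟨(hs.1.1 hz.1.1).1, hcov⟩, s \ {y}, ?_, ?_⟩
  · refine mem_maxChainsIn_of_forall (fun b hb => ⟨(hs.1.1 hb.1).1, hmax b hb.1 hb.2⟩)
      (hs.1.2.mono sdiff_subset) fun w hw h => ⟨?_, (hw.2.trans_lt hzy).ne⟩
    refine mem_of_comparable hs ⟨hw.1, hw.2.trans hzy.le⟩ fun b hb => ?_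
    by_cases hby : b = y
    · exact Or.inr (hby ▸ hw.2.trans hzy.le)
    · exact h b ⟨hb, hby⟩
  · rw [insert_sdiff_singleton, insert_eq_of_mem hys]

/-- Deleting `y` from a maximal chain leaves a maximal chain of `[x, z]` for a unique coatom `z`,
the greatest remaining element. -/
theorem numMaxChains_eq_mul [Finite P] {x y : P} (hxy : x < y) {M : ℕ}
    (h : ∀ z ∈ coatomsIn x y, numMaxChains x z = M) :
    numMaxChains x y = (coatomsIn x y).ncard * M := by
  have key : Nat.card (Σ z : coatomsIn x y, maxChainsIn x z.1) = Nat.card (maxChainsIn x y) := by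
    refine Nat.card_eq_of_bijective
      (fun p => ⟨insert y p.2.1, insert_mem_maxChainsIn p.1.2 p.2.2⟩) ⟨?_, ?_⟩
    · rintro ⟨⟨z, hz⟩, s, hs⟩ ⟨⟨w, hw⟩, t, ht⟩ heq
      have heq : insert y s = insert y t := congrArg Subtype.val heq
      have hys : y ∉ s := fun h => (hs.1.1 h).2.not_gt hz.2.lt
      have hyt : y ∉ t := fun h => (ht.1.1 h).2.not_gt hw.2.lt
      have hst : s = t := by
        have := congrArg (· \ {y}) heq
        simpa [hys, hyt] using this
      subst hst
      have hzs : z ∈ s := mem_of_comparable hs ⟨hz.1, le_rfl⟩ fun b hb => Or.inl (hs.1.1 hb).2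
      have hws : w ∈ s := mem_of_comparable ht ⟨hw.1, le_rfl⟩ fun b hb => Or.inl (ht.1.1 hb).2
      obtain rfl : z = w := le_antisymm (ht.1.1 hzs).2 (hs.1.1 hws).2
      rfl
    · rintro ⟨s, hs⟩
      obtain ⟨z, hz, t, ht, rfl⟩ := exists_insert_eq hxy hs
      exact ⟨⟨⟨z, hz⟩, t, ht⟩, rfl⟩
  have := Fintype.ofFinite (coatomsIn x y)
  rw [numMaxChains_eq_card, ← key, Nat.card_sigma, Finset.sum_congr rfl
    (fun z _ => (numMaxChains_eq_card x z.1).symm.trans (h z.1 z.2)), Finset.sum_const,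
    Finset.card_univ, smul_eq_mul, ← Nat.card_eq_fintype_card, Nat.card_coe_set_eq]

theorem numMaxChains_toDual (x y : P) :
    numMaxChains (OrderDual.toDual y) (OrderDual.toDual x) = numMaxChains x y := by
  rw [numMaxChains_eq_card, numMaxChains_eq_card]
  have : ∀ t : Set P, (t ⊆ Icc x y ∧ IsChain (· ≤ ·) t) ↔
      ((OrderDual.ofDual ⁻¹' t : Set Pᵒᵈ) ⊆ Icc (OrderDual.toDual y) (OrderDual.toDual x) ∧
        IsChain (fun a b : Pᵒᵈ => a ≤ b) (OrderDual.ofDual ⁻¹' t : Set Pᵒᵈ)) := fun t =>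
    ⟨fun h => ⟨fun b hb => ⟨(h.1 hb).2, (h.1 hb).1⟩, fun a ha b hb hab => (h.2 ha hb hab).symm⟩,
      fun h => ⟨fun b hb => ⟨(h.1 hb).2, (h.1 hb).1⟩, fun a ha b hb hab => (h.2 ha hb hab).symm⟩⟩
  refine (Nat.card_congr (Equiv.subtypeEquiv (Equiv.refl (Set P)) fun s => ?_)).symm
  exact ⟨fun h => ⟨(this s).1 h.1, fun t ht => h.2 ((this t).2 ht)⟩,
    fun h => ⟨(this s).2 h.1, fun t ht => h.2 ((this t).1 ht)⟩⟩

theorem numMaxChains_eq_mul_atoms [Finite P] {x y : P} (hxy : x < y) {M : ℕ}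
    (h : ∀ z ∈ atomsIn x y, numMaxChains z y = M) :
    numMaxChains x y = (atomsIn x y).ncard * M := by
  have hco : ∀ z : P, OrderDual.toDual z ∈ coatomsIn (OrderDual.toDual y) (OrderDual.toDual x) ↔
      z ∈ atomsIn x y := fun z => by
    simp only [coatomsIn, atomsIn, mem_ofPred_eq, OrderDual.toDual_le_toDual,
      toDual_covBy_toDual_iff]
    exact and_comm
  rw [← numMaxChains_toDual x y, numMaxChains_eq_mul (M := M)
    (show OrderDual.toDual y < OrderDual.toDual x from hxy)]
  · congr 1
    exact Set.ncard_congr (fun z _ => OrderDual.ofDual z) (fun z hz => (hco z.ofDual).1 hz)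
      (fun _ _ _ _ h => h) fun z hz => ⟨OrderDual.toDual z, (hco z).2 hz, rfl⟩
  · intro z hz
    have := h z.ofDual ((hco z.ofDual).1 hz)
    rw [← numMaxChains_toDual] at this
    exact this

theorem numMaxChains_self (x : P) : numMaxChains x x = 1 := by
  have : maxChainsIn x x = {{x}} := by
    ext s
    constructor
    · intro hs
      have hx : x ∈ s := mem_of_comparable hs ⟨le_rfl, le_rfl⟩ fun b hb => Or.inl (hs.1.1 hb).2
      refine Subset.antisymm (fun b hb => ?_) (singleton_subset_iff.2 hx)
      exact le_antisymm (hs.1.1 hb).2 (hs.1.1 hb).1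
    · rintro rfl
      refine mem_maxChainsIn_of_forall (by simp) (by simp [IsChain]) fun w hw _ => ?_
      exact le_antisymm hw.2 hw.1
  rw [numMaxChains_eq_card, this, Nat.card_coe_set_eq, Set.ncard_singleton]

end Chains

/-! ### Boolean intervals and linked coatoms -/

section Structure

variable {P : Type*} [PartialOrder P]

/-- `[x, y]` is isomorphic to the boolean lattice of rank `m`. -/
def IsBooleanInterval (m : ℕ) (x y : P) : Prop := Nonempty (Icc x y ≃o BooleanLattice m)

theorem IsBooleanInterval.le {m : ℕ} {x y : P} (h : IsBooleanInterval m x y) : x ≤ y := by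
  obtain ⟨e⟩ := h
  exact (e.symm ∅).2.1.trans (e.symm ∅).2.2

/-- The coatoms of a boolean interval determine it. -/
theorem IsBooleanInterval.exists_coords {m : ℕ} {a c : P} (h : IsBooleanInterval m a c) :
    ∃ g : Fin m → P, Function.Injective g ∧ (∀ r, r ∈ coatomsIn a c ↔ ∃ i, g i = r) ∧
      (∀ S : Finset (Fin m), ∃ z, a ≤ z ∧ z ≤ c ∧ ∀ i, z ≤ g i ↔ i ∉ S) ∧
      (∀ z z', a ≤ z → z ≤ c → a ≤ z' → z' ≤ c → (∀ i, z' ≤ g i → z ≤ g i) → z ≤ z') := by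
  have hac := h.le
  obtain ⟨e⟩ := h
  -- The coatoms are the complements of singletons, so lying below the one with index `i` means
  -- omitting `i`.
  have hle : ∀ (z : Icc a c) (i : Fin m), z.1 ≤ (e.symm {i}ᶜ).1 ↔ i ∉ e z := fun z i => by
    rw [Subtype.coe_le_coe, OrderIso.le_symm_apply]
    constructor
    · intro h hi
      simpa using h hi
    · intro h j hj
      simp only [Finset.mem_compl, Finset.mem_singleton]
      rintro rfl
      exact h hj
  have hlast : ∀ z z', a ≤ z → z ≤ c → a ≤ z' → z' ≤ c →
      (∀ i, z' ≤ (e.symm {i}ᶜ).1 → z ≤ (e.symm {i}ᶜ).1) → z ≤ z' := by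
    intro z z' h1 h2 h3 h4 H
    have : e ⟨z, h1, h2⟩ ≤ e ⟨z', h3, h4⟩ := fun i hi => by
      by_contra hi'
      exact (hle ⟨z, h1, h2⟩ i).1 (H i ((hle ⟨z', h3, h4⟩ i).2 hi')) hi
    exact e.le_iff_le.1 this
  have hlt : ∀ i, (e.symm {i}ᶜ).1 < c := fun i => by
    refine lt_of_le_of_ne (e.symm {i}ᶜ).2.2 fun hc => ?_
    have h1 := (hle (e.symm Finset.univ) i).1 ((e.symm _).2.2.trans hc.ge)
    simp at h1
  refine ⟨fun i => (e.symm {i}ᶜ).1, ?_, ?_, ?_, hlast⟩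
  · intro i j hij
    have := e.symm.injective (Subtype.ext hij)
    simpa using this
  · intro r
    constructor
    · rintro ⟨har, hrc⟩
      by_contra! hne
      refine hrc.lt.not_ge (hlast c r hac le_rfl har hrc.le fun i hi => ?_)
      exact absurd ((hrc.eq_or_eq hi (hlt i).le).resolve_right (hlt i).ne) (hne i)
    · rintro ⟨i, rfl⟩
      refine ⟨(e.symm {i}ᶜ).2.1, hlt i, fun w h1 h2 => ?_⟩
      have haw : a ≤ w := (e.symm {i}ᶜ).2.1.trans h1.le
      refine h2.not_ge (hlast c w hac le_rfl haw h2.le fun j hj => ?_)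
      by_cases hij : j = i
      · subst hij
        exact absurd hj h1.not_ge
      · have := (hle (e.symm {i}ᶜ) j).1 (h1.le.trans hj)
        simp [hij] at this
  · intro S
    exact ⟨(e.symm S).1, (e.symm S).2.1, (e.symm S).2.2, fun i => by simp [hle]⟩

theorem IsBooleanInterval.ncard_coatomsIn {m : ℕ} {a c : P} (h : IsBooleanInterval m a c) :
    (coatomsIn a c).ncard = m := by
  obtain ⟨g, hg, hc, -⟩ := h.exists_coords
  have : coatomsIn a c = range g := Set.ext fun r => hc r
  rw [this, ← Nat.card_coe_set_eq, Nat.card_range_of_injective hg, Nat.card_eq_fintype_card,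
    Fintype.card_fin]

theorem IsBooleanInterval.exists_inf {m : ℕ} {a y c c' : P} (h : IsBooleanInterval m a y)
    (hc : c ∈ coatomsIn a y) (hc' : c' ∈ coatomsIn a y) (hne : c ≠ c') :
    ∃ r ∈ coatomsIn a c, r ≤ c' ∧ ∀ z, a ≤ z → z ≤ c → z ≤ c' → z ≤ r := by
  obtain ⟨g, hg, hco, hS, hlast⟩ := h.exists_coords
  obtain ⟨i, rfl⟩ := (hco c).1 hc
  obtain ⟨j, rfl⟩ := (hco c').1 hc'
  obtain ⟨r, har, hry, hr⟩ := hS {i, j}ᶜ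
  simp only [Finset.mem_compl, not_not, Finset.mem_insert, Finset.mem_singleton] at hr
  have hri : r ≤ g i := (hr i).2 (Or.inl rfl)
  have hrj : r ≤ g j := (hr j).2 (Or.inr rfl)
  have hmeet : ∀ z, a ≤ z → z ≤ g i → z ≤ g j → z ≤ r := fun z h1 h2 h3 =>
    hlast z r h1 (h2.trans hc.2.le) har hry fun l hl => by
      rcases (hr l).1 hl with rfl | rfl
      · exact h2
      · exact h3
  refine ⟨r, ⟨har, lt_of_le_of_ne hri ?_, fun w h1 h2 => ?_⟩, hrj, hmeet⟩
  · rintro rfl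
    rcases hc.2.eq_or_eq hrj hc'.2.le with h | h
    · exact hne h.symm
    · exact hc'.2.ne h
  · have haw := har.trans h1.le
    refine h2.not_ge (hlast (g i) w hc.1 hc.2.le haw (h2.le.trans hc.2.le) fun l hl => ?_)
    rcases (hr l).1 (h1.le.trans hl) with rfl | rfl
    · exact le_rfl
    · exact absurd (hmeet w haw h2.le hl) h1.not_ge

theorem IsBooleanInterval.exists_lt_le_le {m : ℕ} {x c r r' : P} (hm : 3 ≤ m)
    (h : IsBooleanInterval m x c) (hr : r ∈ coatomsIn x c) (hr' : r' ∈ coatomsIn x c) :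
    ∃ s, x < s ∧ s ≤ r ∧ s ≤ r' := by
  obtain ⟨g, hg, hco, hS, hlast⟩ := h.exists_coords
  obtain ⟨i, rfl⟩ := (hco r).1 hr
  obtain ⟨j, rfl⟩ := (hco r').1 hr'
  obtain ⟨s, h1, h2, hs⟩ := hS {i, j}ᶜ
  simp only [Finset.mem_compl, not_not, Finset.mem_insert, Finset.mem_singleton] at hs
  refine ⟨s, lt_of_le_of_ne h1 ?_, (hs i).2 (Or.inl rfl), (hs j).2 (Or.inr rfl)⟩
  rintro rfl
  -- A third index exists because `m ≥ 3`. The coatom `g l` is above `x` but not above `s`, which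
  -- rules out `s = x`.
  obtain ⟨l, hl⟩ : ∃ l, l ∉ ({i, j} : Finset (Fin m)) := by
    by_contra! hall
    have h3 : (Finset.univ : Finset (Fin m)).card ≤ ({i, j} : Finset (Fin m)).card :=
      Finset.card_le_card fun l _ => hall l
    have := Finset.card_le_two (a := i) (b := j)
    simp at h3
    omega
  simp only [Finset.mem_insert, Finset.mem_singleton] at hl
  exact hl ((hs l).1 ((hco _).2 ⟨l, rfl⟩).1)

/-- The isomorphism sends `z` to the set of `i` with `a i ≤ z`. The two hypotheses are order
reflection and surjectivity; the `a i` need not be known to be atoms. -/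
theorem isBooleanInterval_of_atoms {m : ℕ} {x y : P} (a : Fin m → P)
    (hinj : ∀ z ∈ Icc x y, ∀ w ∈ Icc x y, (∀ i, a i ≤ z → a i ≤ w) → z ≤ w)
    (hsurj : ∀ S : Finset (Fin m), ∃ z ∈ Icc x y, ∀ i, a i ≤ z ↔ i ∈ S) :
    IsBooleanInterval m x y := by
  classical
  let f : Icc x y → BooleanLattice m := fun z => Finset.univ.filter fun i => a i ≤ z.1
  have hf : ∀ z w, f z ≤ f w ↔ z ≤ w := fun z w => by
    constructor
    · intro h
      refine hinj z.1 z.2 w.1 w.2 fun i hi => ?_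
      have : i ∈ f w := h (by simpa [f] using hi)
      simpa [f] using this
    · intro h i hi
      simp only [f, Finset.mem_filter, Finset.mem_univ, true_and] at hi ⊢
      exact hi.trans h
  refine ⟨RelIso.ofSurjective (OrderEmbedding.ofMapLEIff f hf) fun S => ?_⟩
  obtain ⟨z, hz, h⟩ := hsurj S
  refine ⟨⟨z, hz⟩, ?_⟩
  change f _ = S
  ext i
  simp [f, h]

/-- The elements `> x` of `[x, y]` see the coatoms of `[x, y]` through boolean lattices. -/
structure IsLocallyBoolean (m : ℕ) (x y : P) : Prop where
  le : x < y
  two_le : 2 ≤ m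
  lower : ∀ c ∈ coatomsIn x y, IsBooleanInterval m x c
  upper : ∀ a, x < a → a ≤ y → ∃ k, IsBooleanInterval k a y
  upper_two : ∀ r c, x < r → r ⋖ c → c ⋖ y → IsBooleanInterval 2 r y

namespace IsLocallyBoolean

variable {m : ℕ} {x y : P}

theorem lt_of_mem (h : IsLocallyBoolean m x y) {c r : P} (hc : c ∈ coatomsIn x y)
    (hr : r ∈ coatomsIn x c) : x < r := by
  obtain ⟨g, hg, hco, -⟩ := (h.lower c hc).exists_coords
  refine lt_of_le_of_ne hr.1 ?_
  rintro rfl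
  have key : ∀ i, g i = x := fun i => by
    have hi := (hco _).2 ⟨i, rfl⟩
    exact (hr.2.eq_or_eq hi.1 hi.2.le).resolve_right hi.2.ne
  have := hg ((key ⟨0, by have := h.two_le; omega⟩).trans (key ⟨1, by have := h.two_le; omega⟩).symm)
  simp at this

theorem coatom_lt (h : IsLocallyBoolean m x y) {c : P} (hc : c ∈ coatomsIn x y) : x < c := by
  obtain ⟨g, hg, hco, -⟩ := (h.lower c hc).exists_coords
  have := (hco _).2 ⟨⟨0, by have := h.two_le; omega⟩, rfl⟩
  exact this.1.trans_lt this.2.lt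

/-- The interval `[r, y]` is a boolean lattice of rank 2, so it has exactly two coatoms. -/
theorem exists_other (h : IsLocallyBoolean m x y) {c r : P} (hc : c ∈ coatomsIn x y)
    (hr : r ∈ coatomsIn x c) :
    ∃ c' ∈ coatomsIn x y, c' ≠ c ∧ r ≤ c' ∧ ∀ d ∈ coatomsIn x y, r ≤ d → d = c ∨ d = c' := by
  obtain ⟨g, hg, hco, -⟩ := (h.upper_two r c (h.lt_of_mem hc hr) hr.2 hc.2).exists_coords
  obtain ⟨i, rfl⟩ := (hco c).1 ⟨hr.2.le, hc.2⟩
  have hi : ∀ i l : Fin 2, l = i ∨ l = i + 1 := by decide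
  have hi' : ∀ i : Fin 2, i + 1 ≠ i := by decide
  have h1 := (hco _).2 ⟨i + 1, rfl⟩
  refine ⟨g (i + 1), ⟨hr.1.trans h1.1, h1.2⟩, fun hh => hi' i (hg hh), h1.1, fun d hd hrd => ?_⟩
  obtain ⟨l, rfl⟩ := (hco d).1 ⟨hrd, hd.2⟩
  exact (hi i l).imp (congrArg g) (congrArg g)

/-- Distinct coatoms of `[x, y]` have at most one common lower cover. -/
def UniqueMeets (x y : P) : Prop :=
  ∀ c ∈ coatomsIn x y, ∀ c' ∈ coatomsIn x y, c ≠ c' →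
    ∀ r ∈ coatomsIn x c, ∀ r' ∈ coatomsIn x c, r ≤ c' → r' ≤ c' → r = r'

/-- Two coatoms of `[x, y]` are linked if some element other than `x` is below both. -/
def Linked (x c c' : P) : Prop := ∃ a, x < a ∧ a ≤ c ∧ a ≤ c'

/-- Being linked is transitive on the coatoms of `[x, y]`. -/
def LinkedTrans (x y : P) : Prop :=
  ∀ c ∈ coatomsIn x y, ∀ c' ∈ coatomsIn x y, ∀ c'' ∈ coatomsIn x y,
    Linked x c c' → Linked x c' c'' → Linked x c c''

/-- The meet is taken in the boolean interval `[a, y]`, so it is greatest only among the common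
lower bounds above `a`; different `a` could a priori give different meets. -/
theorem exists_meet (h : IsLocallyBoolean m x y) {c c' a : P} (hc : c ∈ coatomsIn x y)
    (hc' : c' ∈ coatomsIn x y) (hne : c ≠ c') (ha : x < a) (hac : a ≤ c) (hac' : a ≤ c') :
    ∃ r ∈ coatomsIn x c, r ≤ c' ∧ a ≤ r ∧ ∀ z, a ≤ z → z ≤ c → z ≤ c' → z ≤ r := by
  obtain ⟨k, hk⟩ := h.upper a ha (hac.trans hc.2.le)
  obtain ⟨r, hr, h1, h2⟩ := hk.exists_inf ⟨hac, hc.2⟩ ⟨hac', hc'.2⟩ hne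
  exact ⟨r, ⟨ha.le.trans hr.1, hr.2⟩, h1, hr.1, h2⟩

/-- Since `m ≥ 3`, the two lower covers of `c` lie above a common `s > x`, and both must equal the
meet of `c` and `c'` in `[s, y]`. -/
theorem uniqueMeets (h : IsLocallyBoolean m x y) (hm : 3 ≤ m) : UniqueMeets x y := by
  intro c hc c' hc' hne r hr r' hr' hrc hrc'
  obtain ⟨s, hs, h1, h2⟩ := (h.lower c hc).exists_lt_le_le hm hr hr'
  obtain ⟨q, hq, hqc, -, hmax⟩ :=
    h.exists_meet hc hc' hne hs (h1.trans hr.2.le) (h1.trans hrc)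
  have e1 := (hr.2.eq_or_eq (hmax r h1 hr.2.le hrc) hq.2.le).resolve_right hq.2.ne
  have e2 := (hr'.2.eq_or_eq (hmax r' h2 hr'.2.le hrc') hq.2.le).resolve_right hq.2.ne
  exact e1.symm.trans e2

/-- The coatom `c'` meets `c` and `c''` in two of its lower covers, and for `m ≥ 3` these lie above
a common element other than `x`. -/
theorem linkedTrans (h : IsLocallyBoolean m x y) (hm : 3 ≤ m) : LinkedTrans x y := by
  intro c hc c' hc' c'' hc'' h1 h2
  by_cases e1 : c' = c
  · exact e1 ▸ h2
  by_cases e2 : c' = c''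
  · exact e2 ▸ h1
  obtain ⟨a, ha, hac, hac'⟩ := h1
  obtain ⟨b, hb, hbc, hbc'⟩ := h2
  obtain ⟨r, hr, hrc, -⟩ := h.exists_meet hc' hc e1 ha hac' hac
  obtain ⟨q, hq, hqc, -⟩ := h.exists_meet hc' hc'' e2 hb hbc hbc'
  obtain ⟨s, hs, h3, h4⟩ := (h.lower c' hc').exists_lt_le_le hm hr hq
  exact ⟨s, hs, h3.trans hrc, h4.trans hqc⟩

/-- If `c` and `c'` shared both their lower covers `r` and `r'`, a lower cover of the third coatom
`c''` would also lie below `c` or `c'`, hence be `r` or `r'`. That element would then be below three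
coatoms. -/
theorem uniqueMeets_of_ncard (h : IsLocallyBoolean 2 x y) (h3 : (coatomsIn x y).ncard = 3) :
    UniqueMeets x y := by
  intro c hc c' hc' hne r hr r' hr' hrc hrc'
  by_contra hrr
  have two : ∀ d ∈ coatomsIn x y, ∀ p ∈ coatomsIn x d, ∀ q ∈ coatomsIn x d, p ≠ q →
      ∀ z ∈ coatomsIn x d, z = p ∨ z = q := by
    intro d hd p hp q hq hpq z hz
    obtain ⟨g, hg, hco, -⟩ := (h.lower d hd).exists_coords
    obtain ⟨i, rfl⟩ := (hco p).1 hp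
    obtain ⟨j, rfl⟩ := (hco q).1 hq
    obtain ⟨l, rfl⟩ := (hco z).1 hz
    have : ∀ i j l : Fin 2, i ≠ j → l = i ∨ l = j := by decide
    exact (this i j l fun hij => hpq (congrArg g hij)).imp (congrArg g) (congrArg g)
  obtain ⟨c'', hc'', hn⟩ : ∃ c'' ∈ coatomsIn x y, c'' ∉ ({c, c'} : Set P) := by
    by_contra! hall
    have := Set.ncard_le_ncard (s := coatomsIn x y) (t := {c, c'}) hall
    have h2 := Set.ncard_pair hne
    omega
  simp only [mem_insert_iff, mem_singleton_iff, not_or] at hn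
  obtain ⟨g, hg, hco, -⟩ := (h.lower c'' hc'').exists_coords
  have hz := (hco _).2 ⟨0, rfl⟩
  obtain ⟨d, hd, hdne, hzd, -⟩ := h.exists_other hc'' hz
  -- every element of rank one below `c` or `c'` is `r` or `r'`
  have cov : ∀ d ∈ coatomsIn x y, ∀ p ∈ coatomsIn x d, ∀ e ∈ coatomsIn x y, p ≤ e →
      p ∈ coatomsIn x e := by
    intro d hd p hp e he hpe
    refine ⟨hp.1, lt_of_le_of_ne hpe ?_, fun w h1 h2 => ?_⟩
    · rintro rfl
      exact hd.2.lt.not_ge ((he.2.eq_or_eq hp.2.le hd.2.le).elim (fun h => absurd h hp.2.ne') (·.ge))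
    · obtain ⟨g, hg, hco, -⟩ :=
        (h.upper_two p d (h.lt_of_mem hd hp) hp.2 hd.2).exists_coords
      obtain ⟨i, rfl⟩ := (hco d).1 ⟨hp.2.le, hd.2⟩
      by_cases hde : e = g i
      · exact hp.2.2 h1 (hde ▸ h2)
      obtain ⟨q, hq, hqi, hpq, hmax⟩ :=
        h.exists_meet he hd hde (h.lt_of_mem hd hp) hpe hp.2.le
      have : q = p := ((hp.2.eq_or_eq hpq hqi).resolve_right fun hqg => by
        have := hq.2
        rw [hqg] at this
        exact hd.2.2 this.lt he.2.lt)
      rw [this] at hq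
      exact hq.2.2 h1 h2
  have hr1 := cov c hc r hr c' hc' hrc
  have hr2 := cov c hc r' hr' c' hc' hrc'
  have final : ∀ e, (e = c ∨ e = c') → r ∈ coatomsIn x e → r' ∈ coatomsIn x e →
      e ∈ coatomsIn x y → g 0 ≤ e → False := by
    intro e hee hre hre' he hge
    have hge' := cov c'' hc'' _ hz e he hge
    have hcase := two e he r hre r' hre' hrr _ hge'
    have : r ≤ c'' ∨ r' ≤ c'' := hcase.imp (fun e => e.ge.trans hz.2.le) fun e => e.ge.trans hz.2.le
    have aux : ∀ p ∈ coatomsIn x c, p ≤ c' → p ≤ c'' → False := by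
      intro p hp hpc hpc'
      obtain ⟨d, hd, hdne, hzd, hall⟩ := h.exists_other hc hp
      have e1 := (hall c' hc' hpc).resolve_left hne.symm
      have e2 := (hall c'' hc'' hpc').resolve_left hn.1
      exact hn.2 (e2.trans e1.symm)
    exact this.elim (aux r hr hrc) (aux r' hr' hrc')
  have hdcc : d = c ∨ d = c' := by
    by_contra! hcon
    have hsub : ({c, c', c'', d} : Set P) ⊆ coatomsIn x y := by
      rintro _ (rfl | rfl | rfl | rfl) <;> assumption
    have hcard : ({c, c', c'', d} : Set P).ncard = 4 := by
      rw [Set.ncard_insert_of_notMem, Set.ncard_insert_of_notMem, Set.ncard_pair hdne.symm]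
      · simp [Ne.symm hn.2, hcon.2.symm]
      · simp [hne, Ne.symm hn.1, hcon.1.symm]
    have hfin : (coatomsIn x y).Finite := Set.finite_of_ncard_ne_zero (by omega)
    have := Set.ncard_le_ncard hsub hfin
    omega
  rcases hdcc with rfl | rfl
  · exact final d (Or.inl rfl) hr hr' hd hzd
  · exact final d (Or.inr rfl) hr1 hr2 hd hzd

end IsLocallyBoolean

end Structure

/-! ### From linked classes to summations of boolean lattices -/

section Summation

variable {P : Type*} [PartialOrder P] {m : ℕ} {x y : P}

/-- An order isomorphism onto the antisymmetrization of a preorder. -/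
theorem nonempty_orderIso_antisymmetrization {α β : Type*} [Preorder α] [PartialOrder β]
    (f : α → β) (hf : ∀ a b, f a ≤ f b ↔ a ≤ b) (hs : Function.Surjective f) :
    Nonempty (β ≃o Antisymmetrization α (· ≤ ·)) := by
  have hg : ∀ a b : Antisymmetrization α (· ≤ ·),
      f (ofAntisymmetrization (· ≤ ·) a) ≤ f (ofAntisymmetrization (· ≤ ·) b) ↔ a ≤ b :=
    fun a b => (hf _ _).trans ofAntisymmetrization_le_ofAntisymmetrization_iff
  refine ⟨(RelIso.ofSurjective (OrderEmbedding.ofMapLEIff _ hg) fun b => ?_).symm⟩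
  obtain ⟨a, rfl⟩ := hs b
  have h1 := toAntisymmetrization_ofAntisymmetrization (· ≤ ·) (toAntisymmetrization (· ≤ ·) a)
  refine ⟨toAntisymmetrization (· ≤ ·) a, le_antisymm ((hf _ _).2 ?_) ((hf _ _).2 ?_)⟩
  · exact toAntisymmetrization_le_toAntisymmetrization_iff.1 h1.le
  · exact toAntisymmetrization_le_toAntisymmetrization_iff.1 h1.ge

namespace IsLocallyBoolean

/-- Coordinates on the coatoms linked to a given coatom `c`: the lower covers `g i` of `c`, and for
each of them the other coatom `o i` above it. -/
theorem exists_link_coords (h : IsLocallyBoolean m x y) (hu : UniqueMeets x y) {c : P}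
    (hc : c ∈ coatomsIn x y) :
    ∃ g o : Fin m → P,
      (∀ S : Finset (Fin m), ∃ z, x ≤ z ∧ z ≤ c ∧ ∀ i, z ≤ g i ↔ i ∉ S) ∧
      (∀ z z', x ≤ z → z ≤ c → x ≤ z' → z' ≤ c → (∀ i, z' ≤ g i → z ≤ g i) → z ≤ z') ∧
      (∀ i, x ≤ g i) ∧
      Function.Injective o ∧ (∀ i, o i ∈ coatomsIn x y ∧ o i ≠ c) ∧
      (∀ d ∈ coatomsIn x y, Linked x c d ↔ d = c ∨ ∃ i, o i = d) ∧
      (∀ i z, x < z → z ≤ c → (z ≤ o i ↔ z ≤ g i)) := by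
  obtain ⟨g, hg, hco, hS, hlast⟩ := (h.lower c hc).exists_coords
  have hgm : ∀ i, g i ∈ coatomsIn x c := fun i => (hco _).2 ⟨i, rfl⟩
  choose o ho hoc hgo hall using fun i => h.exists_other hc (hgm i)
  refine ⟨g, o, hS, hlast, fun i => (hgm i).1, fun i j hij => hg ?_, fun i => ⟨ho i, hoc i⟩, ?_, ?_⟩
  -- If `o i = o j`, then `g i` and `g j` are common lower covers of the same two coatoms.
  · exact hu c hc (o i) (ho i) (hoc i).symm _ (hgm i) _ (hgm j) (hgo i) (hij ▸ hgo j)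
  · intro d hd
    constructor
    · rintro ⟨a, ha, hac, had⟩
      by_cases hdc : d = c
      · exact Or.inl hdc
      obtain ⟨r, hr, hrd, -⟩ := h.exists_meet hc hd (Ne.symm hdc) ha hac had
      obtain ⟨i, rfl⟩ := (hco r).1 hr
      exact Or.inr ⟨i, ((hall i d hd hrd).resolve_left hdc).symm⟩
    · rintro (rfl | ⟨i, rfl⟩)
      · exact ⟨d, h.coatom_lt hd, le_rfl, le_rfl⟩
      · exact ⟨g i, h.lt_of_mem hc (hgm i), (hgm i).2.le, hgo i⟩
  · intro i z hxz hzc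
    refine ⟨fun hzo => ?_, fun hz => hz.trans (hgo i)⟩
    obtain ⟨r, hr, hro, hzr, -⟩ := h.exists_meet hc (ho i) (hoc i).symm hxz hzc hzo
    rwa [hu c hc (o i) (ho i) (hoc i).symm _ (hgm i) _ hr (hgo i) hro]

theorem ncard_linked (h : IsLocallyBoolean m x y) (hu : UniqueMeets x y) {c : P}
    (hc : c ∈ coatomsIn x y) : {d ∈ coatomsIn x y | Linked x c d}.ncard = m + 1 := by
  obtain ⟨g, o, -, -, -, hinj, ho, hl, -⟩ := h.exists_link_coords hu hc
  have : {d ∈ coatomsIn x y | Linked x c d} = insert c (range o) := by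
    ext d
    constructor
    · rintro ⟨hd, hcd⟩
      exact ((hl d hd).1 hcd)
    · rintro (rfl | ⟨i, rfl⟩)
      · exact ⟨hc, (hl d hc).2 (Or.inl rfl)⟩
      · exact ⟨(ho i).1, (hl _ (ho i).1).2 (Or.inr ⟨i, rfl⟩)⟩
  rw [this, Set.ncard_insert_of_notMem (by rintro ⟨i, hi⟩; exact (ho i).2 hi),
    ← Nat.card_coe_set_eq, Nat.card_range_of_injective hinj, Nat.card_eq_fintype_card,
    Fintype.card_fin]

/-- The coatoms linked to a given one already number three, so any two coatoms are linked. -/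
theorem linkedTrans_of_ncard (h : IsLocallyBoolean 2 x y) (h3 : (coatomsIn x y).ncard = 3) :
    LinkedTrans x y := by
  intro c hc c' hc' c'' hc'' _ _
  have h1 := h.ncard_linked (h.uniqueMeets_of_ncard h3) hc
  have h2 := Set.eq_of_subset_of_ncard_le (sep_subset _ _ :
    {d ∈ coatomsIn x y | Linked x c d} ⊆ _) (by omega) (Set.finite_of_ncard_ne_zero (by omega))
  exact (h2.ge hc'').2

/-- The coatoms are indexed by pairs, the first entry naming the class of linked coatoms. -/
theorem exists_coatom_coords [Finite P] (h : IsLocallyBoolean m x y) (hu : UniqueMeets x y)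
    (ht : LinkedTrans x y) :
    ∃ (k : ℕ) (co : Fin k → Fin (m + 1) → P),
      (∀ c, c ∈ coatomsIn x y ↔ ∃ i j, co i j = c) ∧
      (∀ i j i' j', co i j = co i' j' → i = i' ∧ j = j') ∧
      (∀ i j i' j', Linked x (co i j) (co i' j') ↔ i = i') := by
  let s : Setoid (coatomsIn x y) :=
    { r := fun c d => Linked x c.1 d.1
      iseqv := ⟨fun c => ⟨c, h.coatom_lt c.2, le_rfl, le_rfl⟩,
        fun ⟨a, h1, h2, h3⟩ => ⟨a, h1, h3, h2⟩,
        fun {c c' c''} => ht c.1 c.2 c'.1 c'.2 c''.1 c''.2⟩ }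
  have hcard : ∀ q : Quotient s, Nat.card {c : coatomsIn x y // Quotient.mk s c = q} = m + 1 := by
    intro q
    induction q using Quotient.inductionOn with
    | h c =>
      rw [← h.ncard_linked hu c.2, ← Nat.card_coe_set_eq]
      refine Nat.card_eq_of_bijective (fun d => ⟨d.1.1, d.1.2, ?_⟩) ⟨?_, ?_⟩
      · exact Quotient.exact d.2.symm
      · intro d d' hdd
        have h1 := congrArg Subtype.val hdd
        exact Subtype.ext (Subtype.ext h1)
      · rintro ⟨d, hd, hcd⟩
        exact ⟨⟨⟨d, hd⟩, (Quotient.sound (s := s) (a := c) (b := ⟨d, hd⟩) hcd).symm⟩, rfl⟩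
  let e := Finite.equivFin (Quotient s)
  let f := fun q => Finite.equivFinOfCardEq (hcard q)
  refine ⟨Nat.card (Quotient s), fun i j => ((f (e.symm i)).symm j).1.1, fun c => ⟨fun hc => ?_, ?_⟩,
    ?_, ?_⟩
  · refine ⟨e (Quotient.mk s ⟨c, hc⟩), f _ ⟨⟨c, hc⟩, (e.symm_apply_apply _).symm⟩, ?_⟩
    change ((f _).symm ((f _) _)).1.1 = c
    rw [(f _).symm_apply_apply]
  · rintro ⟨i, j, rfl⟩
    exact ((f (e.symm i)).symm j).1.2
  · intro i j i' j' hij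
    have h1 : ((f (e.symm i)).symm j).1 = ((f (e.symm i')).symm j').1 := Subtype.ext hij
    have h2 : e.symm i = e.symm i' := by
      rw [← ((f (e.symm i)).symm j).2, ← ((f (e.symm i')).symm j').2, h1]
    obtain rfl := e.symm.injective h2
    exact ⟨rfl, (f (e.symm i)).symm.injective (Subtype.ext h1)⟩
  · intro i j i' j'
    rw [← e.symm.injective.eq_iff, ← ((f (e.symm i)).symm j).2, ← ((f (e.symm i')).symm j').2]
    exact (Quotient.eq (r := s)).symm

/-- An interval that is locally boolean is a summation of boolean lattices. -/
theorem exists_kSummation [Finite P] (h : IsLocallyBoolean m x y) (hu : UniqueMeets x y)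
    (ht : LinkedTrans x y) :
    ∃ k : ℕ, 1 ≤ k ∧ (coatomsIn x y).ncard = k * (m + 1) ∧
      Nonempty (Icc x y ≃o KSummation k (BooleanLattice (m + 1))) := by
  classical
  obtain ⟨k, co, hco, hinj, hlink⟩ := h.exists_coatom_coords hu ht
  have hmem : ∀ i j, co i j ∈ coatomsIn x y := fun i j => (hco _).2 ⟨i, j, rfl⟩
  have hbelow : ∀ z, x ≤ z → z < y → ∃ i j, z ≤ co i j := fun z h1 h2 => by
    obtain ⟨c, hzc, hcy⟩ := exists_le_covBy_of_lt h2
    obtain ⟨i, j, rfl⟩ := (hco c).1 ⟨h1.trans hzc, hcy⟩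
    exact ⟨i, j, hzc⟩
  have hclass : ∀ z i j i' j', x < z → z ≤ co i j → z ≤ co i' j' → i = i' :=
    fun z i j i' j' hz h1 h2 => (hlink i j i' j').1 ⟨z, hz, h1, h2⟩
  -- an element below all coatoms of a class is the least one
  have hbot : ∀ z i, x ≤ z → (∀ j, z ≤ co i j) → z = x := fun z i hxz hz => by
    by_contra hne
    have hxz' : x < z := lt_of_le_of_ne hxz (Ne.symm hne)
    obtain ⟨g, o, hS, hlast, hxg, hoinj, ho, hl, hle⟩ :=
      h.exists_link_coords hu (hmem i 0)
    refine hxz'.not_ge (hlast z x hxz (hz 0) le_rfl (hxz.trans (hz 0)) fun l _ => ?_)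
    refine (hle l z hxz' (hz 0)).1 ?_
    obtain ⟨i', j', hij⟩ := (hco _).1 (ho l).1
    have h1 := (hl (o l) (ho l).1).2 (Or.inr ⟨l, rfl⟩)
    rw [← hij] at h1 ⊢
    exact ((hlink _ _ _ _).1 h1) ▸ hz j'
  -- elements are compared through the coatoms above them
  have hcomp : ∀ z z', x < z → x < z' → z' < y → (∀ i j, z' ≤ co i j → z ≤ co i j) → z ≤ z' := by
    intro z z' hz hz' hzy' H
    obtain ⟨i, j, hij⟩ := hbelow z' hz'.le hzy'
    obtain ⟨g, o, hS, hlast, hxg, hoinj, ho, hl, hle⟩ :=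
      h.exists_link_coords hu (hmem i j)
    refine hlast z z' hz.le (H i j hij) hz'.le hij fun l hl' => ?_
    rw [← hle l z hz (H i j hij)]
    rw [← hle l z' hz' hij] at hl'
    obtain ⟨a, b, hab⟩ := (hco _).1 (ho l).1
    rw [← hab] at hl' ⊢
    exact H a b hl'
  -- The element of the copy `i` with coordinate set `S`: the coatoms of class `i` above it are
  -- those with index outside `S`. The last condition does not pin down the ends, since it ignores
  -- other classes, so `x` and `y` are prescribed separately.
  have hex : ∀ (i : Fin k) (S : Finset (Fin (m + 1))), ∃ z : Icc x y,
      (S = ∅ → z.1 = x) ∧ (S = Finset.univ → z.1 = y) ∧ (S ≠ ∅ → x < z.1) ∧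
      (S ≠ Finset.univ → z.1 < y) ∧ ∀ j, z.1 ≤ co i j ↔ j ∉ S := by
    intro i S
    by_cases h0 : S = ∅
    · subst h0
      exact ⟨⟨x, le_rfl, h.le.le⟩, fun _ => rfl, fun hh => absurd hh.symm Finset.univ_nonempty.ne_empty,
        fun hh => absurd rfl hh, fun _ => h.le, fun j => by simpa using (hmem i j).1⟩
    by_cases h1 : S = Finset.univ
    · subst h1
      refine ⟨⟨y, h.le.le, le_rfl⟩, fun hh => absurd hh h0, fun _ => rfl, fun _ => h.le,
        fun hh => absurd rfl hh, fun j => by simpa using (hmem i j).2.lt.not_ge⟩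
    obtain ⟨j, hj⟩ : ∃ j, j ∉ S := by
      by_contra! hall
      exact h1 (Finset.eq_univ_iff_forall.2 hall)
    obtain ⟨g, o, hS, hlast, hxg, hoinj, ho, hl, hle⟩ :=
      h.exists_link_coords hu (hmem i j)
    -- Below the fixed coatom `co i j` the coordinates are the lower covers `g l`; the resulting `b`
    -- translates `l` into the index of the other coatom above `g l`.
    have hcls : ∀ l, ∃ b, co i b = o l ∧ b ≠ j := fun l => by
      obtain ⟨a, b, hab⟩ := (hco _).1 (ho l).1
      have h1 := (hl (o l) (ho l).1).2 (Or.inr ⟨l, rfl⟩)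
      rw [← hab] at h1
      obtain rfl := (hlink _ _ _ _).1 h1
      refine ⟨b, hab, ?_⟩
      rintro rfl
      exact (ho l).2 hab.symm
    choose b hb hbj using hcls
    have hsurj : ∀ j', j' ≠ j → ∃ l, b l = j' := fun j' hj' => by
      rcases (hl _ (hmem i j')).1 ((hlink _ _ _ _).2 rfl) with h2 | ⟨l, h2⟩
      · exact absurd (hinj _ _ _ _ h2).2 hj'
      · exact ⟨l, (hinj _ _ _ _ ((hb l).trans h2)).2⟩
    obtain ⟨z, hxz, hzc, hz⟩ := hS (Finset.univ.filter fun l => b l ∈ S)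
    simp only [Finset.mem_filter, Finset.mem_univ, true_and] at hz
    have hxz' : x < z := by
      refine lt_of_le_of_ne hxz ?_
      rintro rfl
      obtain ⟨j', hj'⟩ := Finset.nonempty_iff_ne_empty.2 h0
      obtain ⟨l, rfl⟩ := hsurj j' (by rintro rfl; exact hj hj')
      exact (hz l).1 (hxg l) hj'
    have hzy : z < y := hzc.trans_lt (hmem i j).2.lt
    refine ⟨⟨z, hxz, hzy.le⟩, fun hh => absurd hh h0, fun hh => absurd hh h1, fun _ => hxz',
      fun _ => hzy, fun j' => ?_⟩
    by_cases hj' : j' = j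
    · subst hj'
      exact iff_of_true hzc hj
    · obtain ⟨l, rfl⟩ := hsurj j' hj'
      rw [hb, ← hz]
      exact hle l z hxz' hzc
  choose G hG0 hG1 hGx hGy hG using hex
  obtain ⟨i0, -, -⟩ := hbelow x le_rfl h.le
  refine ⟨k, Fin.pos i0, ?_, nonempty_orderIso_antisymmetrization
    (fun a : Copies k (BooleanLattice (m + 1)) => G a.idx a.val) ?_ ?_⟩
  · have hbij : Nat.card (Fin k × Fin (m + 1)) = Nat.card (coatomsIn x y) := by
      refine Nat.card_eq_of_bijective (fun p => ⟨co p.1 p.2, hmem _ _⟩) ⟨?_, ?_⟩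
      · rintro ⟨i, j⟩ ⟨i', j'⟩ hij
        obtain ⟨rfl, rfl⟩ := hinj i j i' j' (congrArg Subtype.val hij)
        rfl
      · rintro ⟨c, hc⟩
        obtain ⟨i, j, rfl⟩ := (hco c).1 hc
        exact ⟨(i, j), rfl⟩
    rw [← Nat.card_coe_set_eq, ← hbij]
    simp
  · rintro ⟨i, S⟩ ⟨i', S'⟩
    change (G i S).1 ≤ (G i' S').1 ↔ (S = ∅ ∨ S' = Finset.univ ∨ (i = i' ∧ S ⊆ S'))
    by_cases h0 : S = ∅
    · exact iff_of_true ((hG0 i S h0).trans_le (G i' S').2.1) (Or.inl h0)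
    by_cases h1 : S' = Finset.univ
    · exact iff_of_true ((G i S).2.2.trans (hG1 i' S' h1).ge) (Or.inr (Or.inl h1))
    simp only [h0, h1, false_or]
    have hx := hGx i S h0
    have hy := hGy i' S' h1
    constructor
    · intro hle
      obtain ⟨j, hj⟩ : ∃ j, j ∉ S' := by
        by_contra! hall
        exact h1 (Finset.eq_univ_iff_forall.2 hall)
      obtain ⟨j0, hj0⟩ : ∃ j, j ∉ S := by
        by_contra! hall
        exact (hle.trans_lt hy).ne (hG1 i S (Finset.eq_univ_iff_forall.2 hall))
      obtain rfl := hclass _ i j0 i' j hx ((hG i S j0).2 hj0) (hle.trans ((hG i' S' j).2 hj))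
      refine ⟨rfl, fun l hl => ?_⟩
      by_contra hl'
      exact (hG i S l).1 (hle.trans ((hG i S' l).2 hl')) hl
    · rintro ⟨rfl, hSS⟩
      have h0' : S' ≠ ∅ := by
        rintro rfl
        exact h0 (Finset.subset_empty.1 hSS)
      obtain ⟨j0, hj0⟩ : ∃ j, j ∉ S' := by
        by_contra! hall
        exact h1 (Finset.eq_univ_iff_forall.2 hall)
      refine hcomp _ _ hx (hGx i S' h0') hy fun a b hab => ?_
      obtain rfl := hclass _ i j0 a b (hGx i S' h0') ((hG i S' j0).2 hj0) hab
      exact (hG i S b).2 fun hb => (hG i S' b).1 hab (hSS hb)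
  · rintro ⟨z, hxz, hzy⟩
    by_cases hz0 : z = x
    · exact ⟨⟨i0, ∅⟩, Subtype.ext ((hG0 i0 ∅ rfl).trans hz0.symm)⟩
    by_cases hz1 : z = y
    · exact ⟨⟨i0, Finset.univ⟩, Subtype.ext ((hG1 i0 _ rfl).trans hz1.symm)⟩
    have hxz' : x < z := lt_of_le_of_ne hxz (Ne.symm hz0)
    have hzy' : z < y := lt_of_le_of_ne hzy hz1
    obtain ⟨i, j, hij⟩ := hbelow z hxz hzy'
    let S : Finset (Fin (m + 1)) := Finset.univ.filter fun j => ¬ z ≤ co i j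
    have hS : ∀ j, j ∉ S ↔ z ≤ co i j := fun j => by simp [S]
    have hS0 : S ≠ ∅ := fun hS0 => hz0 (hbot z i hxz fun j => (hS j).1 (by simp [hS0]))
    have hS1 : S ≠ Finset.univ := fun hS1 => (hS j).2 hij (by simp [hS1])
    have hx := hGx i S hS0
    refine ⟨⟨i, S⟩, Subtype.ext (le_antisymm ?_ ?_)⟩
    · refine hcomp _ _ hx hxz' hzy' fun a b hab => ?_
      obtain rfl := hclass _ i j a b hxz' hij hab
      exact (hG i S b).2 ((hS b).2 hab)
    · refine hcomp _ _ hxz' hx (hGy i S hS1) fun a b hab => ?_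
      obtain rfl := hclass _ i j a b hx ((hG i S j).2 ((hS j).2 hij)) hab
      exact (hS b).1 ((hG i S b).1 hab)

end IsLocallyBoolean

/-- The `1`-summation of a poset is the poset itself. -/
theorem nonempty_orderIso_kSummation_one (Q : Type*) [PartialOrder Q] [BoundedOrder Q] :
    Nonempty (Q ≃o KSummation 1 Q) := by
  refine nonempty_orderIso_antisymmetrization (fun a : Copies 1 Q => a.val) ?_
    fun q => ⟨⟨0, q⟩, rfl⟩
  rintro ⟨i, a⟩ ⟨j, b⟩
  change a ≤ b ↔ (a = ⊥ ∨ b = ⊤ ∨ (i = j ∧ a ≤ b))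
  constructor
  · exact fun hab => Or.inr (Or.inr ⟨Subsingleton.elim _ _, hab⟩)
  · rintro (rfl | rfl | ⟨-, hab⟩)
    · exact bot_le
    · exact le_top
    · exact hab

/-- With `m + 1` coatoms there is room for only one class. -/
theorem IsLocallyBoolean.isBooleanInterval [Finite P] (h : IsLocallyBoolean m x y)
    (hu : UniqueMeets x y) (ht : LinkedTrans x y) (hc : (coatomsIn x y).ncard = m + 1) :
    IsBooleanInterval (m + 1) x y := by
  obtain ⟨k, hk, hcard, ⟨e⟩⟩ := h.exists_kSummation hu ht
  obtain rfl : k = 1 := Nat.eq_of_mul_eq_mul_right (Nat.succ_pos m)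
    (by rw [one_mul]; exact hcard.symm.trans hc)
  obtain ⟨f⟩ := nonempty_orderIso_kSummation_one (BooleanLattice (m + 1))
  exact ⟨e.trans f.symm⟩

end Summation

/-! ### Graded intervals of small rank and chain counts in boolean intervals -/

section GradedIntervals

variable {P : Type*} [PartialOrder P] [GradeMinOrder ℕ P]

theorem covBy_iff_grade {z w : P} : z ⋖ w ↔ z ≤ w ∧ grade ℕ w = grade ℕ z + 1 := by
  rw [covBy_iff_lt_covBy_grade (𝕆 := ℕ), Nat.covBy_iff_add_one_eq]
  constructor
  · exact fun h => ⟨h.1.le, h.2.symm⟩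
  · exact fun h => ⟨lt_of_le_of_ne h.1 (by rintro rfl; omega), h.2.symm⟩

theorem eq_of_le_of_grade_le {z w : P} (h : z ≤ w) (hg : grade ℕ w ≤ grade ℕ z) : z = w := by
  by_contra hne
  exact (grade_strictMono (𝕆 := ℕ) (lt_of_le_of_ne h hne)).not_ge hg

theorem IsNInterval.mem_coatomsIn_iff {n : ℕ} {x y c : P} (h : IsNInterval (n + 1) x y) :
    c ∈ coatomsIn x y ↔ x ≤ c ∧ c ≤ y ∧ grade ℕ c = grade ℕ x + n := by
  have := h.2
  simp only [coatomsIn, mem_ofPred_eq, covBy_iff_grade]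
  constructor
  · rintro ⟨h1, h2, h3⟩
    exact ⟨h1, h2, by omega⟩
  · rintro ⟨h1, h2, h3⟩
    exact ⟨h1, h2, by omega⟩

theorem IsNInterval.left_of_mem_coatomsIn {n : ℕ} {x y c : P} (h : IsNInterval (n + 1) x y)
    (hc : c ∈ coatomsIn x y) : IsNInterval n x c :=
  ⟨hc.1, (h.mem_coatomsIn_iff.1 hc).2.2⟩

theorem IsNInterval.right_of_mem_atomsIn {n : ℕ} {x y a : P} (h : IsNInterval (n + 1) x y)
    (ha : a ∈ atomsIn x y) : IsNInterval n a y :=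
  ⟨ha.2, by have := (covBy_iff_grade.1 ha.1).2; have := h.2; omega⟩

theorem IsNInterval.lt {n : ℕ} {x y : P} (h : IsNInterval (n + 1) x y) : x < y :=
  lt_of_le_of_ne h.1 (by rintro rfl; have := h.2; omega)

theorem IsNInterval.isBooleanInterval_zero {x y : P} (h : IsNInterval 0 x y) :
    IsBooleanInterval 0 x y := by
  obtain rfl := eq_of_le_of_grade_le h.1 h.2.le
  refine isBooleanInterval_of_atoms (fun _ => x) (fun z hz w hw _ => hz.2.trans hw.1) fun S => ?_
  exact ⟨x, ⟨le_rfl, le_rfl⟩, fun i => i.elim0⟩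

theorem IsNInterval.isBooleanInterval_one {x y : P} (h : IsNInterval 1 x y) :
    IsBooleanInterval 1 x y := by
  have hc : x ⋖ y := covBy_iff_grade.2 h
  refine isBooleanInterval_of_atoms (fun _ => y) (fun z hz w hw H => ?_) fun S => ?_
  · rcases hc.eq_or_eq hz.1 hz.2 with rfl | rfl
    · exact hw.1
    · exact H 0 le_rfl
  · by_cases hS : 0 ∈ S
    · exact ⟨y, ⟨h.1, le_rfl⟩, fun i => by rw [Subsingleton.elim i 0]; exact iff_of_true le_rfl hS⟩
    · exact ⟨x, ⟨le_rfl, h.1⟩, fun i => by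
        rw [Subsingleton.elim i 0]; exact iff_of_false hc.lt.not_ge hS⟩

/-- The two ends have one parity and the middle elements the other, so the Euler relation leaves
exactly two middle elements. -/
theorem IsNInterval.isBooleanInterval_two {x y : P} (hE : IsEulerian P)
    (h : IsNInterval 2 x y) : IsBooleanInterval 2 x y := by
  have hlt : x < y := h.lt
  have hcase : ∀ z ∈ Icc x y, z = x ∨ z = y ∨ grade ℕ z = grade ℕ x + 1 := by
    intro z hz
    by_cases hzx : z = x
    · exact Or.inl hzx
    by_cases hzy : z = y
    · exact Or.inr (Or.inl hzy)
    have h1 := grade_strictMono (𝕆 := ℕ) (lt_of_le_of_ne hz.1 (Ne.symm hzx))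
    have h2 := grade_strictMono (𝕆 := ℕ) (lt_of_le_of_ne hz.2 hzy)
    have := h.2
    omega
  have hy := h.2
  have hends : ∀ p : ℕ → Prop, p (grade ℕ x) → p (grade ℕ y) → ¬ p (grade ℕ x + 1) →
      {z : P | z ∈ Icc x y ∧ p (grade ℕ z)} = {x, y} := by
    intro p h1 h2 h3
    ext z
    constructor
    · rintro ⟨hz, hp⟩
      rcases hcase z hz with h | h | h
      · exact Or.inl h
      · exact Or.inr h
      · exact absurd (h ▸ hp) h3
    · rintro (rfl | rfl)
      · exact ⟨⟨le_rfl, h.1⟩, h1⟩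
      · exact ⟨⟨h.1, le_rfl⟩, h2⟩
  have hmids : ∀ p : ℕ → Prop, ¬ p (grade ℕ x) → ¬ p (grade ℕ y) → p (grade ℕ x + 1) →
      {z : P | z ∈ Icc x y ∧ p (grade ℕ z)} = coatomsIn x y := by
    intro p h1 h2 h3
    ext z
    rw [IsNInterval.mem_coatomsIn_iff (n := 1) h]
    constructor
    · rintro ⟨hz, hp⟩
      rcases hcase z hz with rfl | rfl | h
      · exact absurd hp h1
      · exact absurd hp h2
      · exact ⟨hz.1, hz.2, h⟩
    · rintro ⟨hz1, hz2, hg⟩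
      exact ⟨⟨hz1, hz2⟩, hg ▸ h3⟩
  have hcard : (coatomsIn x y).ncard = 2 := by
    have := hE x y hlt
    rcases Nat.even_or_odd (grade ℕ x) with hp | hp
    · rw [hends Even hp (by rw [hy]; exact hp.add even_two) (by simp [hp, parity_simps]),
        hmids Odd (by simpa using hp) (by rw [hy]; simp [hp, parity_simps])
          (hp.add_one), Set.ncard_pair hlt.ne] at this
      exact this.symm
    · have hp' : ¬ Even (grade ℕ x) := by simpa using hp
      rw [hends Odd hp (by rw [hy]; exact hp.add_even even_two) (by simp [hp', parity_simps]),
        hmids Even hp' (by rw [hy]; simp [hp', parity_simps])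
          (hp.add_one), Set.ncard_pair hlt.ne] at this
      exact this
  obtain ⟨a, b, hab, hset⟩ := Set.ncard_eq_two.1 hcard
  have hmem : ∀ z, z ∈ coatomsIn x y ↔ z = a ∨ z = b := fun z => by rw [hset]; rfl
  have hcov := fun z => IsNInterval.mem_coatomsIn_iff (n := 1) (c := z) h
  have ha := (hcov a).1 ((hmem a).2 (Or.inl rfl))
  have hb := (hcov b).1 ((hmem b).2 (Or.inr rfl))
  have hnab : ¬ a ≤ b := fun hle => hab (eq_of_le_of_grade_le hle (by omega))
  have hnba : ¬ b ≤ a := fun hle => hab (eq_of_le_of_grade_le hle (by omega)).symm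
  have hnax : ¬ a ≤ x := fun hle => by have := grade_mono (𝕆 := ℕ) hle; omega
  have hnbx : ¬ b ≤ x := fun hle => by have := grade_mono (𝕆 := ℕ) hle; omega
  have hfour : ∀ z ∈ Icc x y, z = x ∨ z = y ∨ z = a ∨ z = b := fun z hz =>
    (hcase z hz).imp id (Or.imp id fun hg => (hmem z).1 ((hcov z).2 ⟨hz.1, hz.2, hg⟩))
  refine isBooleanInterval_of_atoms ![a, b] (fun z hz w hw H => ?_) fun S => ?_
  · have H0 : a ≤ z → a ≤ w := H 0
    have H1 : b ≤ z → b ≤ w := H 1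
    rcases hfour z hz with rfl | rfl | rfl | rfl
    · exact hw.1
    · rcases hfour w hw with rfl | rfl | rfl | rfl
      · exact absurd (H0 ha.2.1) hnax
      · exact le_rfl
      · exact absurd (H1 hb.2.1) hnba
      · exact absurd (H0 ha.2.1) hnab
    · exact H0 le_rfl
    · exact H1 le_rfl
  · simp only [Fin.forall_fin_two, Matrix.cons_val_zero, Matrix.cons_val_one]
    by_cases h0 : 0 ∈ S <;> by_cases h1 : 1 ∈ S
    · exact ⟨y, ⟨h.1, le_rfl⟩, iff_of_true ha.2.1 h0, iff_of_true hb.2.1 h1⟩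
    · exact ⟨a, ⟨ha.1, ha.2.1⟩, iff_of_true le_rfl h0, iff_of_false hnba h1⟩
    · exact ⟨b, ⟨hb.1, hb.2.1⟩, iff_of_false hnab h0, iff_of_true le_rfl h1⟩
    · exact ⟨x, ⟨le_rfl, h.1⟩, iff_of_false hnax h0, iff_of_false hnbx h1⟩

variable (P) in
/-- All intervals of rank at most `k` are boolean. -/
def AllBoolean (k : ℕ) : Prop :=
  ∀ m ≤ k, ∀ u v : P, IsNInterval m u v → IsBooleanInterval m u v

theorem AllBoolean.mono {k l : ℕ} (h : AllBoolean P l) (hkl : k ≤ l) : AllBoolean P k :=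
  fun m hm => h m (hm.trans hkl)

theorem AllBoolean.succ {k : ℕ} (h : AllBoolean P k)
    (h' : ∀ u v : P, IsNInterval (k + 1) u v → IsBooleanInterval (k + 1) u v) :
    AllBoolean P (k + 1) := fun m hm u v huv => by
  rcases Nat.lt_or_ge k m with hlt | hge
  · obtain rfl : m = k + 1 := by omega
    exact h' u v huv
  · exact h m hge u v huv

theorem allBoolean_two (hE : IsEulerian P) : AllBoolean P 2 := fun m hm u v huv => by
  interval_cases m
  · exact huv.isBooleanInterval_zero
  · exact huv.isBooleanInterval_one
  · exact huv.isBooleanInterval_two hE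

variable [Finite P]

theorem AllBoolean.numMaxChains_eq {m : ℕ} (h : AllBoolean P m) :
    ∀ {x y : P}, IsNInterval m x y → numMaxChains x y = m.factorial := by
  induction m with
  | zero =>
    intro x y hxy
    obtain rfl := eq_of_le_of_grade_le hxy.1 hxy.2.le
    exact numMaxChains_self x
  | succ m ih =>
    intro x y hxy
    rw [numMaxChains_eq_mul hxy.lt fun c hc =>
      ih (h.mono (Nat.le_succ m)) (hxy.left_of_mem_coatomsIn hc),
      (h _ le_rfl x y hxy).ncard_coatomsIn, Nat.factorial_succ]

theorem AllBoolean.numMaxChains_eq_coatoms {m : ℕ} (h : AllBoolean P m) {x y : P}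
    (hxy : IsNInterval (m + 1) x y) :
    numMaxChains x y = (coatomsIn x y).ncard * m.factorial :=
  numMaxChains_eq_mul hxy.lt fun _ hc => h.numMaxChains_eq (hxy.left_of_mem_coatomsIn hc)

theorem AllBoolean.numMaxChains_eq_atoms {m : ℕ} (h : AllBoolean P m) {x y : P}
    (hxy : IsNInterval (m + 1) x y) :
    numMaxChains x y = (atomsIn x y).ncard * m.factorial :=
  numMaxChains_eq_mul_atoms hxy.lt fun _ hc => h.numMaxChains_eq (hxy.right_of_mem_atomsIn hc)

/-- Counting maximal chains by their atom or by their coatom gives the same factor `m.factorial`. -/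
theorem AllBoolean.ncard_atomsIn {m : ℕ} (h : AllBoolean P m) {x y : P}
    (hxy : IsNInterval (m + 1) x y) : (atomsIn x y).ncard = (coatomsIn x y).ncard :=
  Nat.eq_of_mul_eq_mul_right m.factorial_pos
    ((h.numMaxChains_eq_atoms hxy).symm.trans (h.numMaxChains_eq_coatoms hxy))

end GradedIntervals

/-! ### Rank numbers, double counting and the Euler relation -/

section RankNumbers

variable {P : Type*} [PartialOrder P] [GradeMinOrder ℕ P]

theorem AllBoolean.isLocallyBoolean {m : ℕ} (hm : 2 ≤ m) (h : AllBoolean P m) {x y : P}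
    (hxy : IsNInterval (m + 1) x y) : IsLocallyBoolean m x y where
  le := hxy.lt
  two_le := hm
  lower c hc := h m le_rfl x c (hxy.left_of_mem_coatomsIn hc)
  upper a hxa hay := by
    have h1 := grade_strictMono (𝕆 := ℕ) hxa
    have h2 := grade_mono (𝕆 := ℕ) hay
    have h3 := hxy.2
    exact ⟨grade ℕ y - grade ℕ a, h _ (by omega) a y ⟨hay, by omega⟩⟩
  upper_two r c _ hrc hcy :=
    h 2 hm r y ⟨hrc.le.trans hcy.le, by
      have h1 := (covBy_iff_grade.1 hrc).2
      have h2 := (covBy_iff_grade.1 hcy).2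
      omega⟩

/-- The number of elements of `[x, y]` of rank `i` in that interval. -/
noncomputable def rankNumber (x y : P) (i : ℕ) : ℕ :=
  {z : P | x ≤ z ∧ z ≤ y ∧ grade ℕ z = grade ℕ x + i}.ncard

theorem rankNumber_zero {x y : P} (h : x ≤ y) : rankNumber x y 0 = 1 := by
  have : {z : P | x ≤ z ∧ z ≤ y ∧ grade ℕ z = grade ℕ x + 0} = {x} := by
    ext z
    constructor
    · rintro ⟨h1, -, h3⟩
      exact (eq_of_le_of_grade_le h1 h3.le).symm
    · rintro rfl
      exact ⟨le_rfl, h, rfl⟩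
  rw [rankNumber, this, Set.ncard_singleton]

theorem rankNumber_self {n : ℕ} {x y : P} (h : IsNInterval n x y) : rankNumber x y n = 1 := by
  have : {z : P | x ≤ z ∧ z ≤ y ∧ grade ℕ z = grade ℕ x + n} = {y} := by
    ext z
    constructor
    · rintro ⟨-, h2, h3⟩
      exact eq_of_le_of_grade_le h2 (h.2.trans h3.symm).le
    · rintro rfl
      exact ⟨h.1, le_rfl, h.2⟩
  rw [rankNumber, this, Set.ncard_singleton]

theorem rankNumber_coatoms {n : ℕ} {x y : P} (h : IsNInterval (n + 1) x y) :
    rankNumber x y n = (coatomsIn x y).ncard :=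
  congrArg Set.ncard (Set.ext fun _ => h.mem_coatomsIn_iff.symm)

variable [Finite P]

/-- For `m = 2` the lattice arguments for unique meets and transitivity are unavailable; having
three coatoms replaces them. -/
theorem AllBoolean.isBooleanInterval {m : ℕ} (hm : 2 ≤ m) (h : AllBoolean P m) {x y : P}
    (hxy : IsNInterval (m + 1) x y) (hc : (coatomsIn x y).ncard = m + 1) :
    IsBooleanInterval (m + 1) x y := by
  have hl := h.isLocallyBoolean hm hxy
  rcases hm.eq_or_lt with rfl | hm3
  · exact hl.isBooleanInterval (hl.uniqueMeets_of_ncard hc) (hl.linkedTrans_of_ncard hc) hc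
  · exact hl.isBooleanInterval (hl.uniqueMeets hm3) (hl.linkedTrans hm3) hc

/-- Double counting of the covering relations between consecutive ranks of `[x, y]`. -/
theorem rankNumber_mul {x y : P} {i a b : ℕ}
    (ha : ∀ z, x ≤ z → z ≤ y → grade ℕ z = grade ℕ x + i → (atomsIn z y).ncard = a)
    (hb : ∀ w, x ≤ w → w ≤ y → grade ℕ w = grade ℕ x + (i + 1) → (coatomsIn x w).ncard = b) :
    rankNumber x y i * a = rankNumber x y (i + 1) * b := by
  classical
  have := Fintype.ofFinite P
  let F : ℕ → Finset P := fun i =>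
    Finset.univ.filter fun z => x ≤ z ∧ z ≤ y ∧ grade ℕ z = grade ℕ x + i
  have hF : ∀ i, rankNumber x y i = (F i).card := fun i => by
    rw [rankNumber, ← Set.ncard_coe_finset]
    congr 1
    ext z
    simp [F]
  rw [hF, hF]
  refine Finset.card_mul_eq_card_mul (fun z w : P => z ⋖ w) (fun z hz => ?_) fun w hw => ?_
  · simp only [F, Finset.mem_filter, Finset.mem_univ, true_and] at hz
    rw [← ha z hz.1 hz.2.1 hz.2.2, ← Set.ncard_coe_finset]
    congr 1
    ext w
    simp only [Finset.bipartiteAbove, F, Finset.coe_filter, Finset.mem_filter, Finset.mem_univ,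
      true_and, mem_ofPred_eq, atomsIn]
    constructor
    · exact fun h => ⟨h.2, h.1.2.1⟩
    · exact fun h => ⟨⟨hz.1.trans h.1.le, h.2, by rw [(covBy_iff_grade.1 h.1).2, hz.2.2]; rfl⟩, h.1⟩
  · simp only [F, Finset.mem_filter, Finset.mem_univ, true_and] at hw
    rw [← hb w hw.1 hw.2.1 hw.2.2, ← Set.ncard_coe_finset]
    congr 1
    ext z
    simp only [Finset.bipartiteBelow, F, Finset.coe_filter, Finset.mem_filter, Finset.mem_univ,
      true_and, mem_ofPred_eq, coatomsIn]
    constructor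
    · exact fun h => ⟨h.1.1, h.2⟩
    · exact fun h => ⟨⟨h.1, h.2.le.trans hw.2.1, by
        have := (covBy_iff_grade.1 h.2).2; omega⟩, h.2⟩

/-- The Euler relation of `[x, y]` in terms of its rank numbers. -/
theorem IsEulerian.sum_rankNumber (hE : IsEulerian P) {n : ℕ} {x y : P}
    (h : IsNInterval n x y) (hlt : x < y) :
    ∑ i ∈ Finset.range (n + 1), (-1 : ℚ) ^ i * rankNumber x y i = 0 := by
  classical
  have := Fintype.ofFinite P
  let S : Finset P := Finset.univ.filter fun z => x ≤ z ∧ z ≤ y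
  have hS : ∀ z, z ∈ S ↔ x ≤ z ∧ z ≤ y := fun z => by simp [S]
  have hzero : ∑ z ∈ S, (-1 : ℚ) ^ grade ℕ z = 0 := by
    have hsplit := Finset.sum_filter_add_sum_filter_not S (fun z => Even (grade ℕ z))
      (fun z => (-1 : ℚ) ^ grade ℕ z)
    rw [← hsplit, Finset.sum_congr rfl (g := fun _ => (1 : ℚ)) fun z hz =>
        (Finset.mem_filter.1 hz).2.neg_one_pow,
      Finset.sum_congr rfl (s₁ := S.filter fun z => ¬ Even (grade ℕ z)) (g := fun _ => (-1 : ℚ))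
        fun z hz => (Nat.not_even_iff_odd.1 (Finset.mem_filter.1 hz).2).neg_one_pow]
    have h1 : (S.filter fun z => Even (grade ℕ z)).card =
        (S.filter fun z => ¬ Even (grade ℕ z)).card := by
      rw [← Set.ncard_coe_finset, ← Set.ncard_coe_finset]
      convert hE x y hlt using 2
      · ext z; simp [hS]
      · ext z; simp [hS]
    simp [h1]
  have hmaps : ∀ z ∈ S, grade ℕ z - grade ℕ x ∈ Finset.range (n + 1) := fun z hz => by
    have h1 := grade_mono (𝕆 := ℕ) ((hS z).1 hz).2
    have := h.2
    rw [Finset.mem_range]; omega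
  rw [← Finset.sum_fiberwise_of_maps_to hmaps] at hzero
  -- Ranks are taken relative to `x`, which costs only the global sign `(-1) ^ grade ℕ x`.
  have hfib : ∀ i, ∑ z ∈ S with grade ℕ z - grade ℕ x = i, (-1 : ℚ) ^ grade ℕ z =
      (-1) ^ grade ℕ x * ((-1) ^ i * rankNumber x y i) := fun i => by
    have hmem : ∀ z, z ∈ S.filter (fun z => grade ℕ z - grade ℕ x = i) ↔
        x ≤ z ∧ z ≤ y ∧ grade ℕ z = grade ℕ x + i := fun z => by
      rw [Finset.mem_filter, hS]
      constructor
      · rintro ⟨⟨h1, h2⟩, h3⟩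
        have := grade_mono (𝕆 := ℕ) h1
        exact ⟨h1, h2, by omega⟩
      · rintro ⟨h1, h2, h3⟩
        exact ⟨⟨h1, h2⟩, by omega⟩
    rw [Finset.sum_congr rfl (g := fun _ => (-1 : ℚ) ^ grade ℕ x * (-1) ^ i) fun z hz => by
      rw [((hmem z).1 hz).2.2, pow_add], Finset.sum_const, nsmul_eq_mul]
    have : (S.filter fun z => grade ℕ z - grade ℕ x = i).card = rankNumber x y i := by
      rw [← Set.ncard_coe_finset, rankNumber]
      congr 1
      ext z
      exact hmem z
    rw [this]; ring
  simp only [hfib] at hzero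
  rw [← Finset.mul_sum] at hzero
  exact (mul_eq_zero.1 hzero).resolve_left (pow_ne_zero _ (by norm_num))

/-- Here `a` and `b` stand for the numbers of atoms and coatoms. If `k` or `k'` were at least 2,
then `a + b` would be at most `3/2 * (e * n)`, but for `n ≥ 4` the right side of `h` exceeds this by
at least 2. Once `k = k' = 1`, the terms in `e * n` cancel and `e = 1`. -/
theorem eq_one_of_euler_relation {k k' n : ℕ} {a b e : ℚ} (hn : 4 ≤ n) (hk : 1 ≤ k)
    (hk' : 1 ≤ k') (he : 0 < e) (ha0 : 0 ≤ a) (hb0 : 0 ≤ b) (ha : a * k' = e * n)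
    (hb : b * k = e * n) (h : a + b = 2 - 2 * e + 2 * (e * n)) : k = 1 ∧ k' = 1 ∧ e = 1 := by
  have hn' : (4 : ℚ) ≤ n := by exact_mod_cast hn
  have hen : 4 * e ≤ e * n := by nlinarith
  have key : ∀ {k : ℕ} {a : ℚ}, 0 ≤ a → 1 ≤ k → a * k = e * n →
      a ≤ e * n ∧ (k ≠ 1 → 2 * a ≤ e * n) := by
    intro k a ha0 hk ha
    refine ⟨?_, fun hk1 => ?_⟩
    · have : (1 : ℚ) ≤ k := by exact_mod_cast hk
      nlinarith
    · have : (2 : ℚ) ≤ k := by exact_mod_cast (show 2 ≤ k by omega)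
      nlinarith
  obtain ⟨a1, a2⟩ := key ha0 hk' ha
  obtain ⟨b1, b2⟩ := key hb0 hk hb
  have e1 : k = 1 := by
    by_contra hne
    linarith [b2 hne]
  have e2 : k' = 1 := by
    by_contra hne
    linarith [a2 hne]
  subst e1 e2
  refine ⟨rfl, rfl, ?_⟩
  simp only [Nat.cast_one, mul_one] at ha hb
  linarith

/-- In an interval of even rank whose intervals of corank at least two are boolean and whose
intervals of corank one are equinumerous summations of boolean lattices, the summations are
trivial. -/
theorem AllBoolean.ncard_of_even {m k k' : ℕ} (hm : 2 ≤ m) (hme : Even m) (hA : AllBoolean P m)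
    (hE : IsEulerian P) {x y : P} (hxy : IsNInterval (m + 2) x y) (hk : 1 ≤ k) (hk' : 1 ≤ k')
    (hlow : ∀ c ∈ coatomsIn x y, (coatomsIn x c).ncard = k * (m + 1))
    (hup : ∀ a ∈ atomsIn x y, (atomsIn a y).ncard = k' * (m + 1)) :
    k = 1 ∧ k' = 1 ∧ (coatomsIn x y).ncard = m + 2 := by
  have hy := hxy.2
  have hlt : x < y := IsNInterval.lt (n := m + 1) hxy
  have hatoms : ∀ i, 2 ≤ i → i ≤ m + 1 → ∀ z, x ≤ z → z ≤ y → grade ℕ z = grade ℕ x + i →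
      (atomsIn z y).ncard = m + 2 - i := by
    intro i h2 hi z h1 hzy hz
    have hI : IsNInterval (m + 1 - i + 1) z y := ⟨hzy, by omega⟩
    rw [(hA.mono (by omega : m + 1 - i ≤ m)).ncard_atomsIn hI,
      (hA _ (by omega) z y hI).ncard_coatomsIn]
    omega
  have hcoatoms : ∀ i, i + 1 ≤ m → ∀ w, x ≤ w → w ≤ y → grade ℕ w = grade ℕ x + (i + 1) →
      (coatomsIn x w).ncard = i + 1 := fun i hi w h1 _ hw =>
    (hA (i + 1) hi x w ⟨h1, hw⟩).ncard_coatomsIn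
  have hmid : ∀ i, 2 ≤ i → i + 1 ≤ m →
      rankNumber x y i * (m + 2 - i) = rankNumber x y (i + 1) * (i + 1) := fun i h2 hi =>
    rankNumber_mul (hatoms i h2 (by omega)) (hcoatoms i hi)
  have hbot : rankNumber x y 1 * (k' * (m + 1)) = rankNumber x y 2 * 2 :=
    rankNumber_mul (fun z h1 h2 h3 => hup z ⟨covBy_iff_grade.2 ⟨h1, h3⟩, h2⟩) (hcoatoms 1 hm)
  have htop : rankNumber x y m * 2 = rankNumber x y (m + 1) * (k * (m + 1)) :=
    rankNumber_mul (fun z h1 h2 h3 => by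
      rw [hatoms m hm (by omega) z h1 h2 h3]; omega)
      fun w h1 h2 h3 => hlow w ((IsNInterval.mem_coatomsIn_iff (n := m + 1) hxy).2 ⟨h1, h2, h3⟩)
  have hchoose : ∀ i ≤ m + 2, ((m + 2).choose i : ℚ) ≠ 0 := fun i hi => by
    exact_mod_cast (Nat.choose_pos hi).ne'
  -- From rank 2 to rank `m` the rank numbers obey the recursion of the binomial coefficients, so
  -- this ratio stays constant.
  obtain ⟨e, he2⟩ : ∃ e : ℚ, (rankNumber x y 2 : ℚ) = e * (m + 2).choose 2 :=
    ⟨_, (div_mul_cancel₀ _ (hchoose 2 (by omega))).symm⟩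
  have hmids : ∀ i, 2 ≤ i → i ≤ m → (rankNumber x y i : ℚ) = e * (m + 2).choose i := by
    intro i h2
    induction i, h2 using Nat.le_induction with
    | base => exact fun _ => he2
    | succ i h2 ih =>
      intro hi
      have h1 := congrArg (Nat.cast (R := ℚ)) (hmid i h2 hi)
      have h3 := congrArg (Nat.cast (R := ℚ)) (Nat.choose_succ_right_eq (m + 2) i)
      rw [Nat.cast_mul, Nat.cast_mul, ih (by omega)] at h1
      rw [Nat.cast_mul, Nat.cast_mul] at h3
      have hpos : ((i + 1 : ℕ) : ℚ) ≠ 0 := by positivity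
      refine mul_right_cancel₀ hpos ?_
      rw [← h1, mul_assoc, mul_assoc, h3]
  have hchoose2 : ((m + 2).choose 2 : ℚ) * 2 = (m + 2) * (m + 1) := by
    have := Nat.choose_succ_right_eq (m + 2) 1
    rw [Nat.choose_one_right] at this
    exact_mod_cast this
  have hm1 : ((m : ℚ) + 1) ≠ 0 := by positivity
  have ha : (rankNumber x y 1 : ℚ) * k' = e * (m + 2 : ℕ) := by
    have h1 := congrArg (Nat.cast (R := ℚ)) hbot
    push_cast at h1 ⊢
    rw [he2, mul_assoc, hchoose2] at h1
    refine mul_right_cancel₀ hm1 ?_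
    linarith
  have hb : (rankNumber x y (m + 1) : ℚ) * k = e * (m + 2 : ℕ) := by
    have h1 := congrArg (Nat.cast (R := ℚ)) htop
    push_cast at h1 ⊢
    rw [hmids m hm le_rfl, ← Nat.choose_symm_of_eq_add (n := m + 2) (a := 2) (b := m) (by omega),
      mul_assoc, hchoose2] at h1
    refine mul_right_cancel₀ hm1 ?_
    linarith
  have he : 0 < e := by
    obtain ⟨c, hxc, hcy⟩ := exists_le_covBy_of_lt hlt
    have hne : (coatomsIn x y).Nonempty := ⟨c, hxc, hcy⟩
    have hpos : 0 < rankNumber x y (m + 1) := by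
      rw [rankNumber_coatoms (n := m + 1) hxy]
      exact (Set.ncard_pos (Set.toFinite _)).2 hne
    have h1 : (0 : ℚ) < rankNumber x y (m + 1) * k := by exact_mod_cast Nat.mul_pos hpos hk
    rw [hb] at h1
    exact pos_of_mul_pos_left h1 (by positivity)
  have hsum := hE.sum_rankNumber hxy hlt
  have halt : ∑ i ∈ Finset.range (m + 2 + 1), (-1 : ℚ) ^ i * (m + 2).choose i = 0 := by
    exact_mod_cast Int.alternating_sum_range_choose_of_ne (n := m + 2) (by omega)
  -- Subtracting `e` times the alternating binomial sum kills ranks 2 to `m`; only the two lowest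
  -- and two highest ranks survive.
  have hdiff : ∑ i ∈ Finset.range (m + 2 + 1),
      (-1 : ℚ) ^ i * (rankNumber x y i - e * (m + 2).choose i) = 0 := by
    simp only [mul_sub, Finset.sum_sub_distrib, hsum, mul_left_comm _ e, ← Finset.mul_sum, halt]
    simp
  obtain ⟨p, rfl⟩ := Nat.exists_eq_add_of_le hm
  rw [Finset.sum_range_succ, Finset.sum_range_succ, show 2 + p + 1 = p + 1 + 1 + 1 by omega,
    Finset.sum_range_succ', Finset.sum_range_succ', Finset.sum_eq_zero fun i hi => by
      rw [hmids (i + 1 + 1) (by omega) (by have := Finset.mem_range.1 hi; omega), sub_self,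
        mul_zero]] at hdiff
  -- Evenness of `m` enters here: ranks 1 and `m + 1` get the same sign, opposite to that of the two
  -- ends.
  have hodd : Odd (p + 1 + 1 + 1) := by
    rw [show p + 1 + 1 + 1 = (2 + p) + 1 by omega]; exact hme.add_one
  have heven : Even (2 + p + 2) := hme.add even_two
  rw [hodd.neg_one_pow, heven.neg_one_pow, rankNumber_zero hxy.1, rankNumber_self hxy,
    Nat.choose_self, Nat.choose_zero_right, show 2 + p + 2 = p + 1 + 1 + 1 + 1 by omega] at hdiff
  rw [show 2 + p + 1 = p + 1 + 1 + 1 by omega, show 2 + p + 2 = p + 1 + 1 + 1 + 1 by omega] at *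
  rw [Nat.choose_succ_self_right, show 0 + 1 = 1 from rfl, Nat.choose_one_right] at hdiff
  obtain ⟨e1, e2, e3⟩ := eq_one_of_euler_relation (by omega) hk hk' he (Nat.cast_nonneg _)
    (Nat.cast_nonneg _) ha hb (by push_cast at hdiff ⊢; linarith)
  refine ⟨e1, e2, ?_⟩
  rw [← rankNumber_coatoms (n := p + 1 + 1 + 1) hxy]
  subst e1 e3
  rw [Nat.cast_one, mul_one, one_mul] at hb
  exact_mod_cast hb

/-- Each coatom accounts for `2! = 2` of the six maximal chains, so there are three coatoms. -/
theorem allBoolean_three (hE : IsEulerian P)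
    (h6 : ∀ x y : P, IsNInterval 3 x y → numMaxChains x y = 6) : AllBoolean P 3 := by
  have hA := allBoolean_two hE
  refine hA.succ fun u v huv => hA.isBooleanInterval le_rfl huv ?_
  have h1 := hA.numMaxChains_eq_coatoms huv
  rw [h6 u v huv] at h1
  simp only [Nat.factorial] at h1
  omega

theorem AllBoolean.exists_kSummation {m : ℕ} (hm : 3 ≤ m) (hA : AllBoolean P m) {x y : P}
    (hxy : IsNInterval (m + 1) x y) :
    ∃ k : ℕ, 1 ≤ k ∧ (coatomsIn x y).ncard = k * (m + 1) ∧
      Nonempty (Icc x y ≃o KSummation k (BooleanLattice (m + 1))) := by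
  have hl := hA.isLocallyBoolean (by omega) hxy
  exact hl.exists_kSummation (hl.uniqueMeets hm) (hl.linkedTrans hm)

end RankNumbers

/-! ### The induction on the rank in a Sheffer poset -/

section Sheffer

variable {P : Type*} [PartialOrder P] [BoundedOrder P] [GradeMinOrder ℕ P]

theorem IsSheffer.numMaxChains_lower (hS : IsSheffer P) {m : ℕ} {x c c' : P}
    (hc : IsNInterval m x c) (hc' : IsNInterval m x c') :
    numMaxChains x c = numMaxChains x c' := by
  by_cases hx : x = ⊥
  · subst hx
    exact hS.sheffer_intervals m c c' hc hc'
  · exact hS.binomial_intervals m x c x c' hx hx hc hc'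

theorem isNInterval_bot_top {n : ℕ} (h : grade ℕ (⊤ : P) = n) : IsNInterval n (⊥ : P) ⊤ :=
  ⟨bot_le, by rw [h, grade_bot]; exact (zero_add n).symm⟩

variable [Finite P]

/-- The lower intervals all start at `x` and the upper ones all start away from `⊥`, so each family
has a constant number of maximal chains and hence a constant multiplicity. The two multiplicities
are kept separate because for `x = ⊥` the families are of different types. -/
theorem AllBoolean.even_interval {m : ℕ} (hm : 2 ≤ m) (hme : Even m) (hA : AllBoolean P m)
    (h3 : AllBoolean P 3) (hE : IsEulerian P) (hS : IsSheffer P) {x y : P}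
    (hxy : IsNInterval (m + 2) x y) :
    (coatomsIn x y).ncard = m + 2 ∧ (∀ c ∈ coatomsIn x y, IsBooleanInterval (m + 1) x c) ∧
      ∀ a ∈ atomsIn x y, IsBooleanInterval (m + 1) a y := by
  have hlt : x < y := IsNInterval.lt (n := m + 1) hxy
  have hdvd : ∀ u v : P, IsNInterval (m + 1) u v →
      ∃ k, 1 ≤ k ∧ (coatomsIn u v).ncard = k * (m + 1) := fun u v huv => by
    -- For `m = 2` the summation theorem does not apply; the rank 3 hypothesis gives multiplicity
    -- one directly.
    rcases hm.eq_or_lt with rfl | hm3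
    · exact ⟨1, le_rfl, by rw [(h3 3 le_rfl u v huv).ncard_coatomsIn]⟩
    · obtain ⟨k, hk, hc, -⟩ := hA.exists_kSummation hm3 huv
      exact ⟨k, hk, hc⟩
  have hlow : ∀ c ∈ coatomsIn x y, IsNInterval (m + 1) x c := fun c hc =>
    IsNInterval.left_of_mem_coatomsIn (n := m + 1) hxy hc
  have hup : ∀ a ∈ atomsIn x y, IsNInterval (m + 1) a y := fun a ha =>
    IsNInterval.right_of_mem_atomsIn (n := m + 1) hxy ha
  obtain ⟨c₀, hc₀⟩ := exists_le_covBy_of_lt hlt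
  obtain ⟨a₀, ha₀⟩ := exists_covBy_le_of_lt hlt
  obtain ⟨k, hk, hkc⟩ := hdvd x c₀ (hlow c₀ hc₀)
  obtain ⟨k', hk', hka⟩ := hdvd a₀ y (hup a₀ ha₀)
  have hlow' : ∀ c ∈ coatomsIn x y, (coatomsIn x c).ncard = k * (m + 1) := fun c hc => by
    rw [← hkc]
    refine Nat.eq_of_mul_eq_mul_right m.factorial_pos ?_
    rw [← hA.numMaxChains_eq_coatoms (hlow c hc), ← hA.numMaxChains_eq_coatoms (hlow c₀ hc₀)]
    exact hS.numMaxChains_lower (hlow c hc) (hlow c₀ hc₀)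
  have hup' : ∀ a ∈ atomsIn x y, (coatomsIn a y).ncard = k' * (m + 1) := fun a ha => by
    rw [← hka]
    refine Nat.eq_of_mul_eq_mul_right m.factorial_pos ?_
    rw [← hA.numMaxChains_eq_coatoms (hup a ha), ← hA.numMaxChains_eq_coatoms (hup a₀ ha₀)]
    exact hS.binomial_intervals (m + 1) a y a₀ y (bot_le.trans_lt ha.1.lt).ne'
      (bot_le.trans_lt ha₀.1.lt).ne' (hup a ha) (hup a₀ ha₀)
  obtain ⟨rfl, rfl, hcard⟩ := hA.ncard_of_even hm hme hE hxy hk hk' hlow' fun a ha => by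
    rw [hA.ncard_atomsIn (hup a ha), hup' a ha]
  exact ⟨hcard,
    fun c hc => hA.isBooleanInterval hm (hlow c hc) (by rw [hlow' c hc, one_mul]),
    fun a ha => hA.isBooleanInterval hm (hup a ha) (by rw [hup' a ha, one_mul])⟩

/-- An interval of rank `m + 1` is enlarged to one of rank `m + 2`: upwards if it starts at `⊥`,
where `m + 2 ≤ n` leaves room below `⊤`, and downwards otherwise. Rank `m + 2` then follows from the
coatom count. -/
theorem AllBoolean.add_two {m n : ℕ} (hm : 2 ≤ m) (hme : Even m) (hA : AllBoolean P m)
    (h3 : AllBoolean P 3) (hE : IsEulerian P) (hS : IsSheffer P)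
    (hrank : grade ℕ (⊤ : P) = n) (hmn : m + 2 ≤ n) : AllBoolean P (m + 2) := by
  have hA1 : AllBoolean P (m + 1) := hA.succ fun u v huv => by
    by_cases hu : u = ⊥
    · have hv : v ≠ ⊤ := by
        rintro rfl
        have h1 := huv.2
        have h2 := (isNInterval_bot_top hrank).2
        rw [hu] at h1
        omega
      obtain ⟨w, hvw, -⟩ := exists_covBy_le_of_lt (lt_top_iff_ne_top.2 hv)
      have huw : IsNInterval (m + 2) u w :=
        ⟨huv.1.trans hvw.le, by rw [(covBy_iff_grade.1 hvw).2, huv.2]; omega⟩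
      exact (hA.even_interval hm hme h3 hE hS huw).2.1 v ⟨huv.1, hvw⟩
    · obtain ⟨w, -, hwu⟩ := exists_le_covBy_of_lt (bot_lt_iff_ne_bot.2 hu)
      have hwv : IsNInterval (m + 2) w v :=
        ⟨hwu.le.trans huv.1, by rw [huv.2, (covBy_iff_grade.1 hwu).2]; omega⟩
      exact (hA.even_interval hm hme h3 hE hS hwv).2.2 u ⟨hwu, huv.1⟩
  exact hA1.succ fun u v huv =>
    hA1.isBooleanInterval (by omega) huv (hA.even_interval hm hme h3 hE hS huv).1

theorem allBoolean_of_even_le {n : ℕ} (hE : IsEulerian P) (hS : IsSheffer P)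
    (h3 : AllBoolean P 3) (hrank : grade ℕ (⊤ : P) = n) (j : ℕ) (hj : 2 * (j + 1) ≤ n) :
    AllBoolean P (2 * (j + 1)) := by
  induction j with
  | zero => exact h3.mono (by omega)
  | succ j ih =>
    exact AllBoolean.add_two (m := 2 * (j + 1)) (by omega) (even_two_mul _) (ih (by omega)) h3 hE hS
      hrank hj

end Sheffer

end ShefferPoset

/-! ### The main theorem -/

theorem mainTheorem3 {P : Type*} [PartialOrder P] [BoundedOrder P] [Finite P] [GradeMinOrder ℕ P]
    (n : ℕ) (hn : 3 ≤ n) (hrank : grade ℕ (⊤ : P) = n)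
    (hEulerian : ShefferPoset.IsEulerian P) (hSheffer : ShefferPoset.IsSheffer P)
    (B D : ℕ → ℕ) (hB : ShefferPoset.IsBinomialFactorial P B)
    (hD : ShefferPoset.IsShefferFactorial P D) (hB3 : B 3 = 6) (hD3 : D 3 = 6) :
    (Odd n → ∃ k : ℕ, 1 ≤ k ∧
      Nonempty (P ≃o ShefferPoset.KSummation k (ShefferPoset.BooleanLattice n))) ∧
    (Even n → Nonempty (P ≃o ShefferPoset.BooleanLattice n)) := by
  have h3 : ShefferPoset.AllBoolean P 3 := by
    refine ShefferPoset.allBoolean_three hEulerian fun x y hxy => ?_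
    by_cases hx : x = ⊥
    · subst hx
      rw [hD 3 y hxy, hD3]
    · rw [hB 3 x y hx hxy, hB3]
  have htop := ShefferPoset.isNInterval_bot_top hrank
  let e : P ≃o Set.Icc (⊥ : P) ⊤ :=
    { toFun := fun z => ⟨z, bot_le, le_top⟩
      invFun := fun z => z.1
      left_inv := fun _ => rfl
      right_inv := fun _ => rfl
      map_rel_iff' := Iff.rfl }
  refine ⟨?_, ?_⟩
  · rintro ⟨j, rfl⟩
    -- Rank 3 is separate: `P` is already boolean there, and the summation theorem needs `m = n - 1
    -- ≥ 3`.
    rcases Nat.eq_or_lt_of_le (show 1 ≤ j by omega) with rfl | hj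
    · obtain ⟨f⟩ := h3 3 le_rfl ⊥ ⊤ htop
      obtain ⟨g⟩ :=
        ShefferPoset.nonempty_orderIso_kSummation_one (ShefferPoset.BooleanLattice 3)
      exact ⟨1, le_rfl, ⟨e.trans (f.trans g)⟩⟩
    · obtain ⟨i, rfl⟩ := Nat.exists_eq_add_of_lt hj
      -- The even rank `2 * (1 + i + 1)` is `n - 1`, so `P` is one rank above the boolean range.
      have hA := ShefferPoset.allBoolean_of_even_le hEulerian hSheffer h3 hrank (1 + i) (by omega)
      obtain ⟨k, hk, -, ⟨f⟩⟩ := hA.exists_kSummation (by omega) htop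
      exact ⟨k, hk, ⟨e.trans f⟩⟩
  · rintro ⟨j, rfl⟩
    obtain ⟨i, rfl⟩ : ∃ i, j = i + 1 := ⟨j - 1, by omega⟩
    have hA := ShefferPoset.allBoolean_of_even_le hEulerian hSheffer h3 hrank i (by omega)
    obtain ⟨f⟩ := hA _ (by omega) ⊥ ⊤ htop
    exact ⟨e.trans f⟩
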